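/- Let $\lambda$ be Lebesgue measure on $\mathbb{R}$. A (scalar) quantizer is a Borel map $q:\mathbb{R}\to\mathbb{R}$ with countable range such that for every $a\in q(\mathbb{R})$ the cell $q^{-1}(a)$ is an interval containing $a$ in its interior. For a Borel probability measure $\mu$ on $\mathbb{R}$, $r>1$ and $\alpha\in(0,1)$ put $$H^\alpha_\mu(q)=\frac1{1-\alpha}\log\sum_{a\in q(\mathbb{R})}\mu(q^{-1}(a))^\alpha\in[0,\infty],\qquad D_\mu(q)=\int|x-q(x)|^r\,d\mu(x),$$ $$D^\alpha_\mu(R)=\inf\{D_\mu(q): q\text{ a quantizer},\ H^\alpha_\mu(q)\le R\}.$$ A sequence of quantizers $(q_n)$ is called asymptotically optimal for $\mu$ if $H^\alpha_\mu(q_n)\to\infty$ and $D_\mu(q_n)/D^\alpha_\mu(H^\alpha_\mu(q_n))\to1$. Let $$\beta_1=\frac{1-\alpha+\alpha r}{1-\alpha+r},\qquad \beta_2=\frac{1-\alpha+r}{1-\alpha},\qquad Q_{\alpha,r}(\nu)=\frac{1}{2^r(1+r)}\Bigl(\int f^{\beta_1}\,d\lambda\Bigr)^{\beta_2}\quad\text{for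 }\nu=f\lambda .$$ A probability density $g$ on $\mathbb{R}$ is called weakly unimodal if it is continuous on its support (the support of the measure $g\lambda$) and there is $l_0>0$ such that $\{x:g(x)\ge l\}$ is a compact interval for every $l\in(0,l_0)$. **Theorem.** Let $r>1$, $\alpha\in(0,1)$, and let $\mu=g\lambda$, where $g$ is a weakly unimodal probability density and $\int|x|^{r+\delta}\,d\mu(x)<\infty$ for some $\delta>0$. Let $(q_n)$ be asymptotically optimal for $\mu$. Let $c<d$ be real numbers with $\mu((c,d])\in(0,1)$, and put $A_1=(c,d]$, $A_2=\mathbb{R}\setminus A_1$ and $\mu_i=\mu(\cdot\mid A_i)$. Then $\int g^{\beta_1}\,d\lambda<\infty$, and for $i\in\{1,2\}$: $$\lim_{n\to\infty}\frac{e^{(1-\alpha)H^\alpha_{\mu_i}(q_n)}}{e^{(1-\alpha)H^\alpha_\mu(q_n)}}=\frac{\int_{A_i}g^{\beta_1}\,d\lambda}{\int_{\mathbb{R}}g^{\beta_1}\,d\lambda}\;\mu(A_i)^{-\alpha};$$ moreover $(q_n)$ is asymptotically optimal for $\mu_i$; and $Q_{\alpha,r}(\mu_i)<\infty$ with $$\lim_{n\to\infty}e^{rH^\alpha_{\mu_i}(q_n)}D_{\mu_i}(q_n)=Q_{\alpha,r}(\mu_i).$$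 -/

import Mathlib

open MeasureTheory ProbabilityTheory Filter Topology
open scoped ENNReal

namespace RenyiQuantization

noncomputable section

/-- `g` is a (Borel) probability density function on `ℝ`. -/
structure IsProbDensity (g : ℝ → ℝ) : Prop where
  measurable : Measurable g
  nonneg : ∀ x, 0 ≤ g x
  lintegral_eq_one : ∫⁻ x, ENNReal.ofReal (g x) = 1

/-- The measure `gλ` with density `g` with respect to Lebesgue measure `λ`. -/
def densityMeasure (g : ℝ → ℝ) : Measure ℝ :=
  volume.withDensity fun x => ENNReal.ofReal (g x)

/-- A probability density `g` is weakly unimodal if it is continuous on its support (the topological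
support of `gλ`) and all its superlevel sets of small enough positive level are compact
intervals. -/
structure IsWeaklyUnimodal (g : ℝ → ℝ) : Prop extends IsProbDensity g where
  continuousOn_support : ContinuousOn g (densityMeasure g).support
  superlevel : ∃ l₀ : ℝ, 0 < l₀ ∧ ∀ l ∈ Set.Ioo 0 l₀,
    ∃ a b : ℝ, a ≤ b ∧ {x | l ≤ g x} = Set.Icc a b

/-- Scalar quantizers: Borel maps with countable range all of whose codecells (the nonempty fibres)
are intervals, each codepoint lying in the interior of its own codecell. -/
structure IsQuantizer (q : ℝ → ℝ) : Prop where
  measurable : Measurable q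
  countable_range : (Set.range q).Countable
  interval : ∀ a ∈ Set.range q, (q ⁻¹' {a}).OrdConnected
  mem_interior : ∀ a ∈ Set.range q, a ∈ interior (q ⁻¹' {a})

/-- Rényi entropy `(1 - α)⁻¹ log ∑ pᵢ ^ α` of order `α` (for `α > 0`, `α ≠ 1`) of a countable
probability vector, with values in the extended reals. -/
def renyiEntropy {ι : Type*} (α : ℝ) (p : ι → ℝ≥0∞) : EReal :=
  (((1 - α)⁻¹ : ℝ) : EReal) * ENNReal.log (∑' i, p i ^ α)

/-- Rényi entropy of order `α` of the quantizer `q` with respect to `μ`. -/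
def quantizerEntropy (α : ℝ) (μ : Measure ℝ) (q : ℝ → ℝ) : EReal :=
  renyiEntropy α fun a : Set.range q => μ (q ⁻¹' {(a : ℝ)})

/-- The `r`-th power distortion `∫ |x - q x| ^ r dμ`. -/
def distortion (r : ℝ) (μ : Measure ℝ) (q : ℝ → ℝ) : ℝ≥0∞ :=
  ∫⁻ x, ENNReal.ofReal (|x - q x| ^ r) ∂μ

/-- The optimal quantization distortion under the entropy constraint `H ≤ R`. -/
def optimalDistortion (r α : ℝ) (μ : Measure ℝ) (R : EReal) : ℝ≥0∞ :=
  ⨅ (q : ℝ → ℝ) (_ : IsQuantizer q ∧ quantizerEntropy α μ q ≤ R), distortion r μ q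

/-- A sequence of quantizers is (`α`-)asymptotically optimal for `μ` if its entropies tend to
infinity and the ratio of its distortions to the optimal ones at the same entropies tends to `1`. -/
structure IsAsymptoticallyOptimal (r α : ℝ) (μ : Measure ℝ) (q : ℕ → ℝ → ℝ) : Prop where
  isQuantizer : ∀ n, IsQuantizer (q n)
  tendsto_entropy : Tendsto (fun n => quantizerEntropy α μ (q n)) atTop (𝓝 ⊤)
  tendsto_ratio : Tendsto (fun n =>
    distortion r μ (q n) / optimalDistortion r α μ (quantizerEntropy α μ (q n))) atTop (𝓝 1)

/-- The exponent `β₁ = (1 - α + α r) / (1 - α + r)`. -/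
def betaOne (r α : ℝ) : ℝ := (1 - α + α * r) / (1 - α + r)

/-- The exponent `β₂ = (1 - α + r) / (1 - α)`. -/
def betaTwo (r α : ℝ) : ℝ := (1 - α + r) / (1 - α)

/-- The quantization coefficient `C(r) (∫ f ^ β₁ dλ) ^ β₂`, where `C(r) = 1 / (2 ^ r (1 + r))` and
`f` is the Lebesgue density of `μ`. -/
def quantizationCoeff (r α : ℝ) (μ : Measure ℝ) : ℝ≥0∞ :=
  ENNReal.ofReal (1 / (2 ^ r * (1 + r))) *
    (∫⁻ x, (μ.rnDeriv volume x) ^ betaOne r α) ^ betaTwo r α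

end

end RenyiQuantization

/-! Write `S` for the sum of the `α`-th powers of the cell probabilities, `D` for the distortion, `t
= r / (1 - α)`, `C = ballConst r` and `w = ∫ h ^ β₁` for a density `h`. Since `e ^ (rH) = S ^ t` and
`β₂ = 1 + t`, everything is about the product `S ^ t * D`.

Lower bound. A cell of length `l` on which the density is at least `i` has distortion at least `C *
i * l ^ (r + 1)` and mass at least `i * l`. Hölder over the cells, with weights `1 / (1 + t)` and `t
/ (1 + t)`, bounds the lower sum `∑ i ^ β₁ * l` by `(D / C) ^ (1 / (1 + t)) * S ^ (t / (1 + t))`. If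
`h` is a.e. continuous, small distortion forces cells to be short where `h` is not small, so `S ^ t
* D ≥ C * W ^ β₂` for each `W < w` once `D` is small (`exists_forall_distortion_lt`).

Upper bound. For bounded `h` with a moment of order `p > r`, a fine mesh is subdivided so that
Hölder is nearly an equality, with dyadic shells for the tails (`exists_quantizer_distortion_le`).
Hence `S ^ t * D → C * w ^ (1 + t)` along asymptotically optimal sequences.

Localization. Cutting the line at `c` and `d` splits at most two cells, so `S₁ + S₂ ≤ S + 2`, while
`D₁ + D₂ = D`. Each part obeys its own lower bound with `wᵢ`, and `w₁ + w₂ = w`. Therefore `(Sᵢ / S)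
^ (t / (1 + t)) * (Dᵢ / D) ^ (1 / (1 + t))` is asymptotically at least `wᵢ / w`. These shares add up
to `1`, so the two-term Hölder inequality is nearly an equality, and its stability (`refined_young`,
`hoelder_stability`) forces `Sᵢ / S` and `Dᵢ / D` to tend to `wᵢ / w` (`tendsto_share`). Dividing by
`μ(Aᵢ)` gives the limits. Optimality for `μᵢ` then needs only the lower bound for `μᵢ`, whose
density is again a.e. continuous (`isAsymptoticallyOptimal_of_tendsto`). -/

namespace RenyiQuantization

/-! ### Moments of sets of given length -/

/-- The constant `1 / (2 ^ r (1 + r))`. -/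
noncomputable def ballConst (r : ℝ) : ℝ := 1 / (2 ^ r * (1 + r))

lemma ballConst_pos {r : ℝ} (hr : 0 < r) : 0 < ballConst r := by
  unfold ballConst; positivity

lemma integral_abs_rpow_symm {r R : ℝ} (hr : 0 < r) (hR : 0 ≤ R) :
    ∫ x in (-R)..R, |x| ^ r = ballConst r * (2 * R) ^ (r + 1) := by
  have hi : ∀ a b : ℝ, IntervalIntegrable (fun x : ℝ => |x| ^ r) volume a b := fun a b =>
    (Continuous.rpow_const (by fun_prop) (fun _ => Or.inr hr.le)).intervalIntegrable a b
  have h1 : ∫ x in (0 : ℝ)..R, |x| ^ r = R ^ (r + 1) / (r + 1) := by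
    rw [intervalIntegral.integral_congr (g := fun x : ℝ => x ^ r), integral_rpow (Or.inl (by linarith))]
    · rw [Real.zero_rpow (by linarith), sub_zero]
    · intro x hx
      rw [Set.uIcc_of_le hR] at hx
      simp only [abs_of_nonneg hx.1]
  have h2 : ∫ x in (-R)..0, |x| ^ r = R ^ (r + 1) / (r + 1) := by
    rw [← h1]
    have := intervalIntegral.integral_comp_neg (a := 0) (b := R) (fun x : ℝ => |x| ^ r)
    simpa using this.symm
  rw [← intervalIntegral.integral_add_adjacent_intervals (hi (-R) 0) (hi 0 R), h1, h2, ballConst,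
    Real.mul_rpow (by norm_num) hR, Real.rpow_add_one (two_ne_zero (α := ℝ)) r]
  have : (2 : ℝ) ^ r ≠ 0 := by positivity
  generalize R ^ (r + 1) = y
  generalize (2 : ℝ) ^ r = z at *
  field_simp
  ring

lemma lintegral_Icc_abs_sub_rpow {r : ℝ} (hr : 0 < r) (a : ℝ) {R : ℝ} (hR : 0 ≤ R) :
    ∫⁻ x in Set.Icc (a - R) (a + R), ENNReal.ofReal (|x - a| ^ r) =
      ENNReal.ofReal (ballConst r * (2 * R) ^ (r + 1)) := by
  have hc : Continuous (fun x : ℝ => |x - a| ^ r) :=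
    Continuous.rpow_const (by fun_prop) (fun _ => Or.inr hr.le)
  rw [← ofReal_integral_eq_lintegral_ofReal hc.continuousOn.integrableOn_Icc
    (Eventually.of_forall fun x => by positivity), integral_Icc_eq_integral_Ioc,
    ← intervalIntegral.integral_of_le (by linarith),
    intervalIntegral.integral_comp_sub_right (fun x => |x| ^ r) a, ← integral_abs_rpow_symm hr hR]
  congr 2 <;> ring

/-- Among all sets of given length, the `r`-th power moment about `a` is least for the interval
centred at `a`. -/
lemma ballConst_mul_volume_rpow_le {r : ℝ} (hr : 0 < r) (a : ℝ) {G : Set ℝ} (hG : MeasurableSet G)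
    (hfin : volume G ≠ ∞) :
    ENNReal.ofReal (ballConst r) * volume G ^ (r + 1) ≤
      ∫⁻ x in G, ENNReal.ofReal (|x - a| ^ r) := by
  set R : ℝ := (volume G).toReal / 2 with hRdef
  have hR : 0 ≤ R := by positivity
  set B := Set.Icc (a - R) (a + R) with hB
  have hBm : MeasurableSet B := measurableSet_Icc
  have hvB : volume B = volume G := by
    rw [hB, Real.volume_Icc, ← ENNReal.ofReal_toReal hfin]
    congr 1; rw [hRdef]; ring
  have hdiff : volume (G \ B) = volume (B \ G) := by
    have h1 := measure_inter_add_sdiff (μ := volume) G hBm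
    have h2 := measure_inter_add_sdiff (μ := volume) B hG
    rw [Set.inter_comm] at h2
    have h3 : volume (G ∩ B) ≠ ∞ := ne_top_of_le_ne_top hfin (measure_mono Set.inter_subset_left)
    rw [hvB, ← h1] at h2
    exact ((ENNReal.add_right_inj h3).1 h2).symm
  have hval : ENNReal.ofReal (ballConst r) * volume G ^ (r + 1) =
      ∫⁻ x in B, ENNReal.ofReal (|x - a| ^ r) := by
    rw [hB, lintegral_Icc_abs_sub_rpow hr a hR, ENNReal.ofReal_mul (ballConst_pos hr).le,
      ← ENNReal.ofReal_rpow_of_nonneg (by positivity) (by positivity)]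
    rw [show 2 * R = (volume G).toReal by rw [hRdef]; ring, ENNReal.ofReal_toReal hfin]
  rw [hval, ← lintegral_inter_add_sdiff _ B hG, ← lintegral_inter_add_sdiff (μ := volume) _ G hBm,
    Set.inter_comm]
  gcongr 1
  -- `B \ G` and `G \ B` have equal measure, and `|x - a|` is at most `R` on the first and at least
  -- `R` on the second.
  calc ∫⁻ x in B \ G, ENNReal.ofReal (|x - a| ^ r)
      ≤ ∫⁻ x in B \ G, ENNReal.ofReal (R ^ r) := by
        refine setLIntegral_mono measurable_const fun x hx => ?_
        have : |x - a| ≤ R := by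
          rw [abs_le]; constructor <;> linarith [hx.1.1, hx.1.2]
        gcongr
    _ = ∫⁻ x in G \ B, ENNReal.ofReal (R ^ r) := by simp [hdiff]
    _ ≤ ∫⁻ x in G \ B, ENNReal.ofReal (|x - a| ^ r) := by
        refine setLIntegral_mono (by fun_prop) fun x hx => ?_
        have : R ≤ |x - a| := by
          by_contra! h
          rw [abs_lt] at h
          exact hx.2 ⟨by linarith, by linarith⟩
        gcongr

/-! ### Entropy in terms of power sums -/

/-- The sum of the `α`-th powers of the codecell probabilities. -/
noncomputable def powerSum (α : ℝ) (μ : Measure ℝ) (q : ℝ → ℝ) : ℝ≥0∞ :=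
  ∑' a : Set.range q, μ (q ⁻¹' {(a : ℝ)}) ^ α

lemma quantizerEntropy_eq (α : ℝ) (μ : Measure ℝ) (q : ℝ → ℝ) :
    quantizerEntropy α μ q = (((1 - α)⁻¹ : ℝ) : EReal) * ENNReal.log (powerSum α μ q) := rfl

/-- This moves all entropy statements into `[0, ∞]`, infinite entropies included. -/
lemma exp_mul_quantizerEntropy (r : ℝ) (α : ℝ) (μ : Measure ℝ) (q : ℝ → ℝ) :
    EReal.exp ((r : EReal) * quantizerEntropy α μ q) = powerSum α μ q ^ (r / (1 - α)) := by
  rw [quantizerEntropy_eq, ← mul_assoc, ← EReal.coe_mul, ← div_eq_mul_inv, ← ENNReal.log_rpow,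
    ENNReal.exp_log]

lemma exp_one_sub_mul_quantizerEntropy {α : ℝ} (hα : α < 1) (μ : Measure ℝ) (q : ℝ → ℝ) :
    EReal.exp (((1 - α : ℝ) : EReal) * quantizerEntropy α μ q) = powerSum α μ q := by
  rw [exp_mul_quantizerEntropy, div_self (by linarith), ENNReal.rpow_one]

lemma quantizerEntropy_le_iff {α : ℝ} (hα : α < 1) (μ : Measure ℝ) (q : ℝ → ℝ) (R : EReal) :
    quantizerEntropy α μ q ≤ R ↔ powerSum α μ q ≤ EReal.exp (((1 - α : ℝ) : EReal) * R) := by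
  have h0 : (0 : ℝ) < 1 - α := by linarith
  have h1 : (0 : EReal) < ((1 - α : ℝ) : EReal) := by exact_mod_cast h0
  rw [← exp_one_sub_mul_quantizerEntropy hα, EReal.exp_le_exp_iff]
  constructor
  · intro h; exact mul_le_mul_of_nonneg_left h h1.le
  · intro h
    have := mul_le_mul_of_nonneg_left h (a := (((1 - α)⁻¹ : ℝ) : EReal))
      (by exact_mod_cast (inv_pos.2 h0).le)
    rwa [← mul_assoc, ← mul_assoc, ← EReal.coe_mul, inv_mul_cancel₀ h0.ne', EReal.coe_one, one_mul,
      one_mul] at this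

lemma quantizerEntropy_le_quantizerEntropy_iff {α : ℝ} (hα : α < 1) (μ : Measure ℝ)
    (q q' : ℝ → ℝ) :
    quantizerEntropy α μ q ≤ quantizerEntropy α μ q' ↔ powerSum α μ q ≤ powerSum α μ q' := by
  rw [quantizerEntropy_le_iff hα, exp_one_sub_mul_quantizerEntropy hα]

lemma tendsto_quantizerEntropy_top_iff {α : ℝ} (hα : α < 1) (μ : Measure ℝ) (q : ℕ → ℝ → ℝ) :
    Tendsto (fun n => quantizerEntropy α μ (q n)) atTop (𝓝 ⊤) ↔
      Tendsto (fun n => powerSum α μ (q n)) atTop (𝓝 ∞) := by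
  have h0 : (0 : ℝ) < 1 - α := by linarith
  have h1 : (0 : EReal) < ((1 - α : ℝ) : EReal) := by exact_mod_cast h0
  have h2 : (0 : EReal) < (((1 - α)⁻¹ : ℝ) : EReal) := by exact_mod_cast inv_pos.2 h0
  constructor
  · intro h
    have h3 : Tendsto (fun n => ((1 - α : ℝ) : EReal) * quantizerEntropy α μ (q n)) atTop
        (𝓝 ⊤) := by
      have := EReal.Tendsto.const_mul (a := ((1 - α : ℝ) : EReal)) h (Or.inr (by simp))
        (Or.inl (EReal.coe_ne_top _))
      simpa only [EReal.mul_top_of_pos h1] using this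
    have := (ENNReal.continuous_exp.tendsto ⊤).comp h3
    simpa only [Function.comp_def, exp_one_sub_mul_quantizerEntropy hα, EReal.exp_top] using this
  · intro h
    have h3 := (ENNReal.continuous_log.tendsto ⊤).comp h
    rw [ENNReal.log_top] at h3
    have := EReal.Tendsto.const_mul (a := (((1 - α)⁻¹ : ℝ) : EReal)) h3 (Or.inr (by simp))
      (Or.inl (EReal.coe_ne_top _))
    rw [EReal.mul_top_of_pos h2] at this
    exact this

/-! ### Exponents and Hölder's inequality over the cells -/

lemma betaOne_eq {r α : ℝ} (hr : 0 < r) (hα₁ : α < 1) :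
    betaOne r α = 1 / (1 + r / (1 - α)) + α * (r / (1 - α) / (1 + r / (1 - α))) := by
  have : 1 - α ≠ 0 := by linarith
  have : 1 - α + r ≠ 0 := by linarith
  unfold betaOne; field_simp

lemma betaOne_pos {r α : ℝ} (hr : 0 < r) (hα₀ : 0 < α) (hα₁ : α < 1) : 0 < betaOne r α := by
  have : 0 < 1 - α := by linarith
  unfold betaOne; positivity

lemma betaTwo_eq {r α : ℝ} (hα₁ : α < 1) : betaTwo r α = 1 + r / (1 - α) := by
  have : 1 - α ≠ 0 := by linarith
  unfold betaTwo; field_simp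

/-- The Hölder weights are the ones for which the powers of the length `l` add up to `1`, so that
the cell bounds form a Riemann sum; the power left on `i` is then `β₁`. -/
lemma rpow_betaOne_mul_eq {r α : ℝ} (hr : 0 < r) (hα₀ : 0 < α) (hα₁ : α < 1) (i l : ℝ≥0∞) :
    (i * l ^ (r + 1)) ^ (1 / (1 + r / (1 - α))) *
      ((i * l) ^ α) ^ (r / (1 - α) / (1 + r / (1 - α))) = i ^ betaOne r α * l := by
  have h1 : 0 < 1 - α := by linarith
  have h2 : 0 < r / (1 - α) := by positivity
  rw [betaOne_eq hr hα₁]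
  set t := r / (1 - α) with ht
  have hr' : r = t * (1 - α) := by rw [ht]; field_simp
  have h3 : (r + 1) * (1 / (1 + t)) + α * (t / (1 + t)) = 1 := by
    rw [hr']; field_simp; ring
  rw [← ENNReal.rpow_mul, ENNReal.mul_rpow_of_nonneg _ _ (by positivity),
    ENNReal.mul_rpow_of_nonneg _ _ (by positivity), ← ENNReal.rpow_mul,
    ENNReal.rpow_add_of_nonneg _ _ (by positivity) (by positivity)]
  have h4 : l = l ^ ((r + 1) * (1 / (1 + t))) * l ^ (α * (t / (1 + t))) := by
    rw [← ENNReal.rpow_add_of_nonneg _ _ (by positivity) (by positivity), h3, ENNReal.rpow_one]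
  nth_rewrite 3 [h4]
  ring

lemma tsum_rpow_mul_rpow_le {ι : Type*} (f g : ι → ℝ≥0∞) {p q : ℝ} (hp : 0 ≤ p) (hq : 0 ≤ q)
    (hpq : p + q = 1) :
    ∑' i, f i ^ p * g i ^ q ≤ (∑' i, f i) ^ p * (∑' i, g i) ^ q := by
  let _ : MeasurableSpace ι := ⊤
  have := ENNReal.lintegral_mul_norm_pow_le (μ := Measure.count) (measurable_from_top (f := f)).aemeasurable
    (measurable_from_top (f := g)).aemeasurable hp hq hpq
  simpa only [lintegral_count] using this

lemma IsQuantizer.measurableSet_cell {q : ℝ → ℝ} (hq : IsQuantizer q) (a : ℝ) :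
    MeasurableSet (q ⁻¹' {a}) := hq.measurable (measurableSet_singleton a)

lemma IsQuantizer.lintegral_eq_tsum {q : ℝ → ℝ} (hq : IsQuantizer q) (ν : Measure ℝ)
    (f : ℝ → ℝ≥0∞) :
    ∫⁻ x, f x ∂ν = ∑' a : Set.range q, ∫⁻ x in q ⁻¹' {(a : ℝ)}, f x ∂ν := by
  have : Countable (Set.range q) := hq.countable_range.to_subtype
  rw [← lintegral_iUnion (fun a : Set.range q => hq.measurableSet_cell a), ← setLIntegral_univ]
  · congr 2
    ext x
    simp
  · intro a b hab
    refine Set.disjoint_left.2 fun x hx hx' => hab ?_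
    exact Subtype.ext ((Set.mem_singleton_iff.1 hx).symm.trans hx')

/-- Contribution to the distortion of a part `G` of a codecell on which the density is at least
`l`. -/
lemma mul_volume_rpow_le_setLIntegral {r : ℝ} (hr : 0 < r) {h : ℝ → ℝ≥0∞} (hh : Measurable h)
    {q : ℝ → ℝ} {a : ℝ} {G : Set ℝ} (hG : MeasurableSet G) (hsub : G ⊆ q ⁻¹' {a})
    (hfin : volume G ≠ ∞) {l : ℝ≥0∞} (hl : ∀ x ∈ G, l ≤ h x) :
    ENNReal.ofReal (ballConst r) * (l * volume G ^ (r + 1)) ≤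
      ∫⁻ x in G, ENNReal.ofReal (|x - q x| ^ r) ∂(volume.withDensity h) := by
  have hm : Measurable fun x : ℝ => ENNReal.ofReal (|x - a| ^ r) := by fun_prop
  calc ENNReal.ofReal (ballConst r) * (l * volume G ^ (r + 1))
      = l * (ENNReal.ofReal (ballConst r) * volume G ^ (r + 1)) := by ring
    _ ≤ l * ∫⁻ x in G, ENNReal.ofReal (|x - a| ^ r) := by
        gcongr; exact ballConst_mul_volume_rpow_le hr a hG hfin
    _ = ∫⁻ x in G, l * ENNReal.ofReal (|x - a| ^ r) := (lintegral_const_mul _ hm).symm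
    _ ≤ ∫⁻ x in G, h x * ENNReal.ofReal (|x - a| ^ r) := by
        refine setLIntegral_mono (by fun_prop) fun x hx => ?_
        gcongr; exact hl x hx
    _ = ∫⁻ x in G, ENNReal.ofReal (|x - a| ^ r) ∂(volume.withDensity h) := by
        rw [setLIntegral_withDensity_eq_setLIntegral_mul _ hh hm hG]; rfl
    _ = ∫⁻ x in G, ENNReal.ofReal (|x - q x| ^ r) ∂(volume.withDensity h) := by
        refine setLIntegral_congr_fun hG fun x hx => ?_
        rw [show q x = a from hsub hx]

/-- One term of the Hölder sum: the first factor comes from the moment bound for the cell, the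
second from its mass, both with the density replaced by its infimum on the cell. -/
lemma iInf_rpow_betaOne_mul_volume_le {r α : ℝ} (hr : 0 < r) (hα₀ : 0 < α) (hα₁ : α < 1)
    {h : ℝ → ℝ≥0∞} (hh : Measurable h) {q : ℝ → ℝ} (hq : IsQuantizer q) (a : ℝ)
    (hfin : volume (q ⁻¹' {a}) ≠ ∞) :
    (⨅ x ∈ q ⁻¹' {a}, h x) ^ betaOne r α * volume (q ⁻¹' {a}) ≤
      ((ENNReal.ofReal (ballConst r))⁻¹ *
          ∫⁻ x in q ⁻¹' {a}, ENNReal.ofReal (|x - q x| ^ r) ∂(volume.withDensity h)) ^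
        (1 / (1 + r / (1 - α))) *
      ((volume.withDensity h) (q ⁻¹' {a}) ^ α) ^ (r / (1 - α) / (1 + r / (1 - α))) := by
  have h1 : 0 < 1 - α := by linarith
  have h2 : 0 < r / (1 - α) := by positivity
  have hI := hq.measurableSet_cell a
  set i := ⨅ x ∈ q ⁻¹' {a}, h x
  have hi : ∀ x ∈ q ⁻¹' {a}, i ≤ h x := fun x hx => iInf₂_le x hx
  have hC : ENNReal.ofReal (ballConst r) ≠ 0 := by simpa using ballConst_pos hr
  rw [← rpow_betaOne_mul_eq hr hα₀ hα₁]
  refine mul_le_mul' (ENNReal.rpow_le_rpow ?_ (by positivity))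
    (ENNReal.rpow_le_rpow (ENNReal.rpow_le_rpow ?_ hα₀.le) (by positivity))
  · rw [← ENNReal.mul_le_iff_le_inv hC ENNReal.ofReal_ne_top]
    exact mul_volume_rpow_le_setLIntegral hr hh hI subset_rfl hfin hi
  · rw [withDensity_apply _ hI]
    calc i * volume (q ⁻¹' {a}) = ∫⁻ x in q ⁻¹' {a}, i := by simp
      _ ≤ _ := setLIntegral_mono hh hi

/-! ### The lower bound for quantizers of small distortion -/

/-- The mesh cell number `j` of the mesh of width `1 / L`, together with its two neighbours. -/
def wideCell (L : ℕ) (j : ℤ) : Set ℝ := Set.Ico ((j - 1 : ℝ) / L) ((j + 2 : ℝ) / L)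

/-- Local lower bound for `h` on the scale `1 / L`. -/
noncomputable def localInf (h : ℝ → ℝ≥0∞) (L : ℕ) (x : ℝ) : ℝ≥0∞ :=
  ⨅ y ∈ wideCell L ⌊L * x⌋, h y

lemma measurable_localInf (h : ℝ → ℝ≥0∞) (L : ℕ) : Measurable (localInf h L) :=
  (measurable_of_countable (fun j : ℤ => ⨅ y ∈ wideCell L j, h y)).comp
    (Int.measurable_floor.comp (measurable_const_mul _))

/-- An interval through `x` that leaves the three mesh cells around `x` must cross one of the two
outer ones completely. -/
lemma subset_wideCell_or_exists {L : ℕ} (hL : 0 < L) {I : Set ℝ} (hI : I.OrdConnected) {x : ℝ}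
    (hx : x ∈ I) :
    I ⊆ wideCell L ⌊L * x⌋ ∨
      ∃ u : ℝ, Set.Ioo u (u + 1 / L) ⊆ I ∧ Set.Ioo u (u + 1 / L) ⊆ wideCell L ⌊L * x⌋ := by
  have hL' : (0 : ℝ) < L := by exact_mod_cast hL
  set j := ⌊L * x⌋
  have hj1 : (j : ℝ) / L ≤ x := by
    rw [div_le_iff₀ hL', mul_comm]; exact Int.floor_le _
  have hj2 : x < ((j : ℝ) + 1) / L := by
    rw [lt_div_iff₀ hL', mul_comm]; exact Int.lt_floor_add_one _
  rw [or_iff_not_imp_left]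
  intro hns
  obtain ⟨y, hy, hyn⟩ := Set.not_subset.1 hns
  by_cases hyx : y < ((j : ℝ) - 1) / L
  · refine ⟨((j : ℝ) - 1) / L, fun z hz => ?_, fun z hz => ?_⟩
    · refine hI.out hy hx ⟨(hyx.trans hz.1).le, ?_⟩
      have : ((j : ℝ) - 1) / L + 1 / L = j / L := by ring
      linarith [hz.2]
    · refine ⟨hz.1.le, hz.2.trans_le ?_⟩
      rw [← add_div]
      exact div_le_div_of_nonneg_right (by linarith) hL'.le
  · have hy2 : ((j : ℝ) + 2) / L ≤ y := by
      by_contra! hlt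
      exact hyn ⟨not_lt.1 hyx, hlt⟩
    have e : ((j : ℝ) + 1) / L + 1 / L = (j + 2) / L := by ring
    refine ⟨((j : ℝ) + 1) / L, fun z hz => ?_, fun z hz => ?_⟩
    · exact hI.out hx hy ⟨(hj2.trans hz.1).le, by linarith [hz.2]⟩
    · refine ⟨?_, by rw [← e]; exact hz.2⟩
      refine le_trans ?_ hz.1.le
      gcongr; linarith

/-- The truncation keeps only points whose whole neighbourhood has density at least `1 / (n + 1)`.
The threshold tends to `0`, so nothing is lost in the limit, and for fixed `n` it makes long cells
costly. -/
lemma rpow_le_liminf_localInf {β : ℝ} (hβ : 0 < β) {h : ℝ → ℝ≥0∞} {x : ℝ}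
    (hx : ContinuousAt h x) :
    h x ^ β ≤ liminf (fun n : ℕ =>
      if (1 : ℝ≥0∞) / (n + 1 : ℕ) ≤ localInf h (n + 1) x then localInf h (n + 1) x ^ β else 0)
      atTop := by
  refine le_of_forall_lt fun c hc => ?_
  have hc' : c ^ β⁻¹ < h x := by
    rwa [ENNReal.rpow_inv_lt_iff hβ]
  obtain ⟨b, hb1, hb2⟩ := exists_between hc'
  refine lt_of_lt_of_le ((ENNReal.rpow_inv_lt_iff hβ).1 hb1) (le_liminf_of_le (by isBoundedDefault) ?_)
  obtain ⟨ε, hε, hball⟩ := Metric.mem_nhds_iff.1 (hx.eventually (lt_mem_nhds hb2))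
  have h1 : ∀ᶠ n : ℕ in atTop, (3 : ℝ) / (n + 1 : ℕ) < ε :=
    ((tendsto_const_div_atTop_nhds_zero_nat (3 : ℝ)).comp (tendsto_add_atTop_nat 1)).eventually
      (gt_mem_nhds hε)
  have h2 : ∀ᶠ n : ℕ in atTop, (1 : ℝ≥0∞) / (n + 1 : ℕ) ≤ b := by
    have := (ENNReal.tendsto_inv_nat_nhds_zero.comp (tendsto_add_atTop_nat 1)).eventually
      (gt_mem_nhds (bot_lt_of_lt hb1))
    filter_upwards [this] with n hn
    rw [one_div]
    exact hn.le
  filter_upwards [h1, h2] with n hn1 hn2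
  have hm : b ≤ localInf h (n + 1) x := by
    refine le_iInf₂ fun y hy => (hball ?_ : b < h y).le
    have hL' : (0 : ℝ) < (n + 1 : ℕ) := by positivity
    have e1 := Int.floor_le (((n + 1 : ℕ) : ℝ) * x)
    have e2 := Int.lt_floor_add_one (((n + 1 : ℕ) : ℝ) * x)
    have e3 := hy.1
    have e4 := hy.2
    rw [div_le_iff₀ hL'] at e3
    rw [lt_div_iff₀ hL'] at e4
    rw [div_lt_iff₀ hL'] at hn1
    rw [Metric.mem_ball, Real.dist_eq, abs_lt]
    constructor <;> nlinarith
  rw [if_pos (hn2.trans hm)]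
  gcongr

/-- Lower bound in the high-rate regime: quantizers with small distortion satisfy the asymptotic
lower bound up to an arbitrarily small loss. -/
theorem exists_forall_distortion_lt {r α : ℝ} (hr : 0 < r) (hα₀ : 0 < α) (hα₁ : α < 1)
    {h : ℝ → ℝ≥0∞} (hh : Measurable h) (hc : ∀ᵐ x, ContinuousAt h x) {W : ℝ≥0∞}
    (hW : W < ∫⁻ x, h x ^ betaOne r α) :
    ∃ η : ℝ≥0∞, 0 < η ∧ ∀ q, IsQuantizer q → distortion r (volume.withDensity h) q < η →
      ENNReal.ofReal (ballConst r) * W ^ betaTwo r α ≤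
        powerSum α (volume.withDensity h) q ^ (r / (1 - α)) *
          distortion r (volume.withDensity h) q := by
  have hβ := betaOne_pos hr hα₀ hα₁
  have h1 : 0 < 1 - α := by linarith
  have ht : 0 < r / (1 - α) := by positivity
  set ν := volume.withDensity h with hν
  set β := betaOne r α with hβdef
  let F : ℕ → ℝ → ℝ≥0∞ := fun n x =>
    if (1 : ℝ≥0∞) / (n + 1 : ℕ) ≤ localInf h (n + 1) x then localInf h (n + 1) x ^ β else 0
  have hFm : ∀ n, Measurable (F n) := fun n =>
    Measurable.ite (measurableSet_le measurable_const (measurable_localInf h (n + 1)))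
      ((measurable_localInf h (n + 1)).pow_const β) measurable_const
  have hfatou : ∫⁻ x, h x ^ β ≤ liminf (fun n => ∫⁻ x, F n x) atTop :=
    (lintegral_mono_ae (hc.mono fun x hx => rpow_le_liminf_localInf hβ hx)).trans
      (lintegral_liminf_le hFm)
  -- By Fatou's lemma some fixed scale already has truncated integral above `W`; the rest of the
  -- proof stays on this scale.
  obtain ⟨n, hn⟩ := (frequently_lt_of_lt_limsup (by isBoundedDefault)
    (hW.trans_le (hfatou.trans liminf_le_limsup))).exists
  set L := n + 1 with hL
  have hL0 : 0 < L := by omega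
  have hC : ENNReal.ofReal (ballConst r) ≠ 0 := by simpa using ballConst_pos hr
  -- `η` is the distortion forced by a single codecell containing an interval of length `1 / L` on
  -- which the density is at least `1 / L`.
  refine ⟨ENNReal.ofReal (ballConst r) * ((1 : ℝ≥0∞) / L *
    ENNReal.ofReal (1 / L) ^ (r + 1)), ?_, fun q hq hD => ?_⟩
  · have : 0 < ENNReal.ofReal (1 / (L : ℝ)) := by
      rw [ENNReal.ofReal_pos]; positivity
    refine ENNReal.mul_pos hC (mul_ne_zero (by simp) ?_)
    exact (ENNReal.rpow_pos this ENNReal.ofReal_ne_top).ne'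
  have hcell : ∀ a : ℝ, ∫⁻ x in q ⁻¹' {a}, F n x ≤
      ((ENNReal.ofReal (ballConst r))⁻¹ *
          ∫⁻ x in q ⁻¹' {a}, ENNReal.ofReal (|x - q x| ^ r) ∂ν) ^ (1 / (1 + r / (1 - α))) *
      (ν (q ⁻¹' {a}) ^ α) ^ (r / (1 - α) / (1 + r / (1 - α))) := by
    intro a
    by_cases hex : ∃ x ∈ q ⁻¹' {a}, (1 : ℝ≥0∞) / L ≤ localInf h L x
    swap
    · push Not at hex
      rw [setLIntegral_congr_fun (g := fun _ => 0) (hq.measurableSet_cell a) fun x hx =>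
        if_neg (hex x hx).not_ge]
      simp
    -- A codecell with a point above the threshold cannot cross a full mesh cell, as this would cost
    -- distortion `η`. It lies in the wide cell, so the local infimum is at most the infimum over
    -- the codecell.
    have hsub : ∀ x ∈ q ⁻¹' {a}, (1 : ℝ≥0∞) / L ≤ localInf h L x →
        q ⁻¹' {a} ⊆ wideCell L ⌊L * x⌋ := by
      intro x hx hxl
      refine (subset_wideCell_or_exists hL0 (hq.interval a ⟨x, hx⟩) hx).resolve_right ?_
      rintro ⟨u, hu1, hu2⟩
      refine hD.not_ge ?_
      have hvol : volume (Set.Ioo u (u + 1 / (L : ℝ))) = ENNReal.ofReal (1 / L) := by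
        rw [Real.volume_Ioo]; congr 1; ring
      have := mul_volume_rpow_le_setLIntegral hr hh (measurableSet_Ioo) hu1 (by simp)
        (l := (1 : ℝ≥0∞) / L) fun y hy => hxl.trans (iInf₂_le y (hu2 hy))
      rw [hvol] at this
      exact this.trans (setLIntegral_le_lintegral _ _)
    obtain ⟨x, hx, hxl⟩ := hex
    have hfin : volume (q ⁻¹' {a}) ≠ ∞ :=
      ne_top_of_le_ne_top (by simp [wideCell]) (measure_mono (hsub x hx hxl))
    refine le_trans ?_ (iInf_rpow_betaOne_mul_volume_le hr hα₀ hα₁ hh hq a hfin)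
    calc ∫⁻ x in q ⁻¹' {a}, F n x ≤ ∫⁻ x in q ⁻¹' {a}, (⨅ x ∈ q ⁻¹' {a}, h x) ^ β := by
          refine setLIntegral_mono measurable_const fun y hy => ?_
          by_cases hyl : (1 : ℝ≥0∞) / L ≤ localInf h L y
          · rw [show F n y = localInf h L y ^ β from if_pos hyl]
            gcongr
            exact le_iInf₂ fun z hz => iInf₂_le z (hsub y hy hyl hz)
          · rw [show F n y = 0 from if_neg hyl]
            exact zero_le
      _ = _ := by simp [hβdef]
  have hsum : W ≤ ((ENNReal.ofReal (ballConst r))⁻¹ * distortion r ν q) ^ (1 / (1 + r / (1 - α))) *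
      powerSum α ν q ^ (r / (1 - α) / (1 + r / (1 - α))) := by
    refine hn.le.trans ?_
    rw [hq.lintegral_eq_tsum]
    refine (ENNReal.tsum_le_tsum fun a : Set.range q => hcell a).trans ?_
    rw [distortion, hq.lintegral_eq_tsum, ← ENNReal.tsum_mul_left, powerSum]
    exact tsum_rpow_mul_rpow_le _ _ (by positivity) (by positivity) (by field_simp)
  have h3 : W ^ (1 + r / (1 - α)) ≤ ((ENNReal.ofReal (ballConst r))⁻¹ * distortion r ν q) *
      powerSum α ν q ^ (r / (1 - α)) := by
    refine (ENNReal.rpow_le_rpow hsum (by positivity)).trans_eq ?_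
    rw [ENNReal.mul_rpow_of_nonneg _ _ (by positivity), ← ENNReal.rpow_mul, ← ENNReal.rpow_mul,
      one_div_mul_cancel (by positivity), div_mul_cancel₀ _ (by positivity), ENNReal.rpow_one]
  rw [betaTwo_eq hα₁]
  calc _ ≤ ENNReal.ofReal (ballConst r) * (((ENNReal.ofReal (ballConst r))⁻¹ *
        distortion r ν q) * powerSum α ν q ^ (r / (1 - α))) := by gcongr
    _ = _ := by
      rw [← mul_assoc, ← mul_assoc, ENNReal.mul_inv_cancel hC ENNReal.ofReal_ne_top, one_mul,
        mul_comm]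

/-! ### Quantizers built from interval partitions -/

/-- The half-open intervals `[u i, v i)` are nondegenerate and partition the line. -/
structure IsIcoPartition {ι : Type*} (u v : ι → ℝ) : Prop where
  lt : ∀ i, u i < v i
  exists_mem : ∀ x, ∃ i, x ∈ Set.Ico (u i) (v i)
  unique : ∀ x i j, x ∈ Set.Ico (u i) (v i) → x ∈ Set.Ico (u j) (v j) → i = j

/-- Every point is sent to the midpoint of its interval. A midpoint lies in its own interval, hence
determines the index, so the fibres are exactly the intervals. -/
lemma IsIcoPartition.exists_quantizer {ι : Type*} [Countable ι] {u v : ι → ℝ}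
    (h : IsIcoPartition u v) :
    ∃ q, IsQuantizer q ∧ Set.range q ⊆ Set.range (fun i => (u i + v i) / 2) ∧
      ∀ i, q ⁻¹' {(u i + v i) / 2} = Set.Ico (u i) (v i) := by
  choose c hc using h.exists_mem
  have hmid : ∀ i, (u i + v i) / 2 ∈ Set.Ico (u i) (v i) := fun i => by
    have := h.lt i
    constructor <;> linarith
  have hcell : ∀ i, (fun x => (u (c x) + v (c x)) / 2) ⁻¹' {(u i + v i) / 2} =
      Set.Ico (u i) (v i) := by
    intro i
    ext x
    constructor
    · intro hx
      have hx' : (u (c x) + v (c x)) / 2 = (u i + v i) / 2 := hx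
      have := h.unique _ (c x) i (hmid (c x)) (hx' ▸ hmid i)
      exact this ▸ hc x
    · intro hx
      simp only [Set.mem_preimage, Set.mem_singleton_iff]
      rw [h.unique x (c x) i (hc x) hx]
  have hrange : Set.range (fun x => (u (c x) + v (c x)) / 2) ⊆
      Set.range (fun i => (u i + v i) / 2) := by
    rintro _ ⟨x, rfl⟩
    exact ⟨c x, rfl⟩
  refine ⟨fun x => (u (c x) + v (c x)) / 2, ⟨?_, ?_, ?_, ?_⟩, hrange, hcell⟩
  · intro s _
    have : (fun x => (u (c x) + v (c x)) / 2) ⁻¹' s =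
        ⋃ i ∈ {i | (u i + v i) / 2 ∈ s}, Set.Ico (u i) (v i) := by
      ext x
      simp only [Set.mem_preimage, Set.mem_ofPred_eq, Set.mem_iUnion, exists_prop]
      constructor
      · exact fun hx => ⟨c x, hx, hc x⟩
      · rintro ⟨i, hi, hxi⟩
        rwa [h.unique x (c x) i (hc x) hxi]
    rw [this]
    exact MeasurableSet.biUnion (Set.to_countable _) fun i _ => measurableSet_Ico
  · exact (Set.countable_range _).mono hrange
  · rintro a ha
    obtain ⟨i, rfl⟩ := hrange ha
    simp only [hcell]
    exact Set.ordConnected_Ico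
  · rintro a ha
    obtain ⟨i, rfl⟩ := hrange ha
    simp only [hcell, interior_Ico]
    have := h.lt i
    constructor <;> linarith

lemma IsIcoPartition.exists_quantizer_le {ι : Type*} [Countable ι] {u v : ι → ℝ}
    (h : IsIcoPartition u v) (r α : ℝ) (ν : Measure ℝ) :
    ∃ q, IsQuantizer q ∧ powerSum α ν q ≤ ∑' i, ν (Set.Ico (u i) (v i)) ^ α ∧
      distortion r ν q ≤ ∑' i, ∫⁻ x in Set.Ico (u i) (v i),
        ENNReal.ofReal (|x - (u i + v i) / 2| ^ r) ∂ν := by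
  obtain ⟨q, hq, hrange, hcell⟩ := h.exists_quantizer
  refine ⟨q, hq, ?_⟩
  choose f hf using fun a : Set.range q => hrange a.2
  have hfi : Function.Injective f := fun a b hab => Subtype.ext (by rw [← hf a, ← hf b, hab])
  constructor
  · rw [powerSum]
    refine le_trans (le_of_eq ?_) (ENNReal.tsum_comp_le_tsum_of_injective hfi _)
    refine tsum_congr fun a => ?_
    simp only [← hcell, hf]
  · rw [distortion, hq.lintegral_eq_tsum]
    refine le_trans (le_of_eq ?_) (ENNReal.tsum_comp_le_tsum_of_injective hfi _)
    refine tsum_congr fun a => ?_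
    simp only [← hcell, hf]
    refine setLIntegral_congr_fun (hq.measurableSet_cell a) fun x hx => ?_
    rw [show q x = a from hx]

/-- Division of each cell `i` of a partition into `N i` cells of equal length. -/
lemma IsIcoPartition.subdivide {ι : Type*} {u v : ι → ℝ} (h : IsIcoPartition u v) (N : ι → ℕ)
    (hN : ∀ i, 0 < N i) :
    IsIcoPartition (fun p : Σ i, Fin (N i) => u p.1 + (p.2 : ℕ) * ((v p.1 - u p.1) / N p.1))
      (fun p : Σ i, Fin (N i) => u p.1 + ((p.2 : ℕ) + 1) * ((v p.1 - u p.1) / N p.1)) := by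
  have hw : ∀ i, 0 < (v i - u i) / N i := fun i =>
    div_pos (sub_pos.2 (h.lt i)) (by exact_mod_cast hN i)
  have hmul : ∀ i, (N i : ℝ) * ((v i - u i) / N i) = v i - u i := fun i =>
    mul_div_cancel₀ _ (by exact_mod_cast (hN i).ne')
  have hsub : ∀ (i : ι) (k : Fin (N i)) (x : ℝ), u i + (k : ℕ) * ((v i - u i) / N i) ≤ x →
      x < u i + ((k : ℕ) + 1) * ((v i - u i) / N i) → x ∈ Set.Ico (u i) (v i) := by
    intro i k x h1 h2
    have h3 : ((k : ℕ) : ℝ) + 1 ≤ N i := by exact_mod_cast k.2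
    have h4 : (((k : ℕ) : ℝ) + 1) * ((v i - u i) / N i) ≤ v i - u i := by
      exact (mul_le_mul_of_nonneg_right h3 (hw i).le).trans_eq (hmul i)
    have h5 : 0 ≤ ((k : ℕ) : ℝ) * ((v i - u i) / N i) := mul_nonneg (by positivity) (hw i).le
    exact ⟨by linarith, by linarith⟩
  refine ⟨fun p => ?_, fun x => ?_, ?_⟩
  · have := hw p.1
    linarith
  · obtain ⟨i, hi⟩ := h.exists_mem x
    have h0 : 0 ≤ (x - u i) / ((v i - u i) / N i) := div_nonneg (by linarith [hi.1]) (hw i).le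
    have h1 := Nat.floor_le h0
    have h2 := Nat.lt_floor_add_one ((x - u i) / ((v i - u i) / N i))
    have h3 : ⌊(x - u i) / ((v i - u i) / N i)⌋₊ < N i := by
      rw [Nat.floor_lt h0, div_lt_iff₀ (hw i), hmul]
      linarith [hi.2]
    rw [le_div_iff₀ (hw i)] at h1
    rw [div_lt_iff₀ (hw i)] at h2
    refine ⟨⟨i, ⟨_, h3⟩⟩, ?_, ?_⟩ <;> simp only <;> linarith
  · rintro x ⟨i, k⟩ ⟨j, l⟩ ⟨h1, h2⟩ ⟨h3, h4⟩
    simp only at h1 h2 h3 h4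
    obtain rfl := h.unique x i j (hsub i k x h1 h2) (hsub j l x h3 h4)
    have e1 : ((k : ℕ) : ℝ) < (l : ℕ) + 1 :=
      lt_of_mul_lt_mul_right (by linarith) (hw i).le
    have e2 : ((l : ℕ) : ℝ) < (k : ℕ) + 1 :=
      lt_of_mul_lt_mul_right (by linarith) (hw i).le
    have e3 : (k : ℕ) < l + 1 := by exact_mod_cast e1
    have e4 : (l : ℕ) < k + 1 := by exact_mod_cast e2
    have : k = l := Fin.ext (by omega)
    rw [this]

/-- A crude bound by mass alone, for the tails; on the core the sharp constant comes from the next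
lemma. -/
lemma setLIntegral_Ico_abs_sub_midpoint_le_mul_measure {r : ℝ} (hr : 0 < r) (ν : Measure ℝ) {a b : ℝ} :
    ∫⁻ x in Set.Ico a b, ENNReal.ofReal (|x - (a + b) / 2| ^ r) ∂ν ≤
      ENNReal.ofReal (b - a) ^ r * ν (Set.Ico a b) := by
  rw [← setLIntegral_const]
  refine setLIntegral_mono measurable_const fun x hx => ?_
  rw [ENNReal.ofReal_rpow_of_nonneg (by linarith [hx.1, hx.2]) hr.le]
  have : |x - (a + b) / 2| ≤ b - a := by
    rw [abs_le]; constructor <;> linarith [hx.1, hx.2]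
  gcongr

lemma setLIntegral_Ico_abs_sub_midpoint_le_of_le {r : ℝ} (hr : 0 < r) {h : ℝ → ℝ≥0∞}
    (hh : Measurable h) {a b : ℝ} (hab : a ≤ b) {M : ℝ≥0∞} (hM : ∀ x ∈ Set.Ico a b, h x ≤ M) :
    ∫⁻ x in Set.Ico a b, ENNReal.ofReal (|x - (a + b) / 2| ^ r) ∂(volume.withDensity h) ≤
      ENNReal.ofReal (b - a) ^ r * (ENNReal.ofReal (ballConst r) * M * ENNReal.ofReal (b - a)) := by
  have hm : Measurable fun x : ℝ => ENNReal.ofReal (|x - (a + b) / 2| ^ r) := by fun_prop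
  rw [setLIntegral_withDensity_eq_setLIntegral_mul _ hh hm measurableSet_Ico]
  calc ∫⁻ x in Set.Ico a b, (h * fun x => ENNReal.ofReal (|x - (a + b) / 2| ^ r)) x
      ≤ ∫⁻ x in Set.Ico a b, M * ENNReal.ofReal (|x - (a + b) / 2| ^ r) :=
        setLIntegral_mono (by fun_prop) fun x hx => mul_le_mul_left (hM x hx) _
    _ = M * ∫⁻ x in Set.Ico a b, ENNReal.ofReal (|x - (a + b) / 2| ^ r) :=
        lintegral_const_mul _ hm
    _ ≤ M * ∫⁻ x in Set.Icc a b, ENNReal.ofReal (|x - (a + b) / 2| ^ r) := by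
        gcongr; exact Set.Ico_subset_Icc_self
    _ = _ := by
        have := lintegral_Icc_abs_sub_rpow hr ((a + b) / 2) (R := (b - a) / 2) (by linarith)
        rw [show (a + b) / 2 - (b - a) / 2 = a by ring, show (a + b) / 2 + (b - a) / 2 = b by ring]
          at this
        rw [this, show 2 * ((b - a) / 2) = b - a by ring,
          ENNReal.ofReal_mul (ballConst_pos hr).le,
          ← ENNReal.ofReal_rpow_of_nonneg (by linarith) (by positivity),
          ENNReal.rpow_add_of_nonneg _ _ hr.le zero_le_one, ENNReal.rpow_one]
        ring

/-- Equal subdivision into `N i` pieces raises the power sum by at most the factor `N i ^ (1 - α)`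
(Hölder against the constant `1`) and divides lengths by `N i`. The minimum keeps the crude and the
sharp distortion bounds available at once. -/
lemma IsIcoPartition.exists_quantizer_subdivide {ι : Type*} [Countable ι] {u v : ι → ℝ}
    (hp : IsIcoPartition u v) (N : ι → ℕ) (hN : ∀ i, 0 < N i) {r α : ℝ} (hr : 0 < r)
    (hα₀ : 0 < α) (hα₁ : α < 1) {h : ℝ → ℝ≥0∞} (hh : Measurable h) (M : ι → ℝ≥0∞)
    (hM : ∀ i, ∀ x ∈ Set.Ico (u i) (v i), h x ≤ M i) :
    ∃ q, IsQuantizer q ∧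
      powerSum α (volume.withDensity h) q ≤
        ∑' i, (N i : ℝ≥0∞) ^ (1 - α) * (volume.withDensity h) (Set.Ico (u i) (v i)) ^ α ∧
      distortion r (volume.withDensity h) q ≤
        ∑' i, (ENNReal.ofReal (v i - u i) / N i) ^ r *
          min ((volume.withDensity h) (Set.Ico (u i) (v i)))
            (ENNReal.ofReal (ballConst r) * M i * ENNReal.ofReal (v i - u i)) := by
  have hpN := hp.subdivide N hN
  obtain ⟨q, hq, hS, hD⟩ := hpN.exists_quantizer_le r α (volume.withDensity h)
  set u' := fun p : Σ i, Fin (N i) => u p.1 + (p.2 : ℕ) * ((v p.1 - u p.1) / N p.1) with hu'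
  set v' := fun p : Σ i, Fin (N i) => u p.1 + ((p.2 : ℕ) + 1) * ((v p.1 - u p.1) / N p.1) with hv'
  have hw : ∀ i, 0 < (v i - u i) / N i := fun i =>
    div_pos (sub_pos.2 (hp.lt i)) (by exact_mod_cast hN i)
  have hlen : ∀ p, v' p - u' p = (v p.1 - u p.1) / N p.1 := fun p => by
    simp only [hu', hv']; ring
  have hlen' : ∀ p, ENNReal.ofReal (v' p - u' p) = ENNReal.ofReal (v p.1 - u p.1) / N p.1 :=
    fun p => by
      rw [hlen, ENNReal.ofReal_div_of_pos (by exact_mod_cast hN p.1), ENNReal.ofReal_natCast]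
  have hsub : ∀ p, Set.Ico (u' p) (v' p) ⊆ Set.Ico (u p.1) (v p.1) := by
    rintro ⟨i, k⟩
    have h3 : ((k : ℕ) : ℝ) + 1 ≤ N i := by exact_mod_cast k.2
    have h4 : (((k : ℕ) : ℝ) + 1) * ((v i - u i) / N i) ≤ v i - u i := by
      refine (mul_le_mul_of_nonneg_right h3 (hw i).le).trans_eq ?_
      exact mul_div_cancel₀ _ (by exact_mod_cast (hN i).ne')
    have h5 : 0 ≤ ((k : ℕ) : ℝ) * ((v i - u i) / N i) := mul_nonneg (by positivity) (hw i).le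
    exact Set.Ico_subset_Ico (by simp only [hu']; linarith) (by simp only [hv']; linarith)
  have hmeas : ∀ i, ∑' k : Fin (N i), (volume.withDensity h) (Set.Ico (u' ⟨i, k⟩) (v' ⟨i, k⟩)) ≤
      (volume.withDensity h) (Set.Ico (u i) (v i)) := by
    intro i
    rw [← measure_iUnion _ fun _ => measurableSet_Ico]
    · exact measure_mono (Set.iUnion_subset fun k => hsub ⟨i, k⟩)
    · intro k l hkl
      refine Set.disjoint_left.2 fun x hx hx' => hkl ?_
      have := hpN.unique x ⟨i, k⟩ ⟨i, l⟩ hx hx'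
      simpa using this
  refine ⟨q, hq, hS.trans ?_, hD.trans ?_⟩
  · rw [ENNReal.tsum_sigma']
    refine ENNReal.tsum_le_tsum fun i => ?_
    have := tsum_rpow_mul_rpow_le (fun k : Fin (N i) =>
      (volume.withDensity h) (Set.Ico (u' ⟨i, k⟩) (v' ⟨i, k⟩))) (fun _ => 1) hα₀.le
      (sub_nonneg.2 hα₁.le) (by ring)
    simp only [ENNReal.one_rpow, mul_one] at this
    refine this.trans ?_
    rw [mul_comm]
    refine mul_le_mul' (ENNReal.rpow_le_rpow (by simp) (by linarith))
      (ENNReal.rpow_le_rpow (hmeas i) hα₀.le)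
  · rw [ENNReal.tsum_sigma']
    refine ENNReal.tsum_le_tsum fun i => ?_
    rw [mul_min]
    refine le_min ?_ ?_
    · calc _ ≤ ∑' k : Fin (N i), (ENNReal.ofReal (v i - u i) / N i) ^ r *
            (volume.withDensity h) (Set.Ico (u' ⟨i, k⟩) (v' ⟨i, k⟩)) := by
            refine ENNReal.tsum_le_tsum fun k => ?_
            rw [← hlen' ⟨i, k⟩]
            exact setLIntegral_Ico_abs_sub_midpoint_le_mul_measure hr _
        _ ≤ _ := by
            rw [ENNReal.tsum_mul_left]
            gcongr
            exact hmeas i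
    · calc _ ≤ ∑' k : Fin (N i), (ENNReal.ofReal (v i - u i) / N i) ^ r *
            (ENNReal.ofReal (ballConst r) * M i * (ENNReal.ofReal (v i - u i) / N i)) := by
            refine ENNReal.tsum_le_tsum fun k => ?_
            rw [← hlen' ⟨i, k⟩]
            exact setLIntegral_Ico_abs_sub_midpoint_le_of_le hr hh (hpN.lt _).le
              fun x hx => hM i x (hsub ⟨i, k⟩ hx)
        _ = _ := by
            rw [ENNReal.tsum_mul_left, ENNReal.tsum_mul_left, tsum_fintype, Finset.sum_const,
              Finset.card_univ, Fintype.card_fin, nsmul_eq_mul, ENNReal.mul_div_cancel (by exact_mod_cast (hN i).ne') (by simp)]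

/-- Quantizers with prescribed relative numbers `ρ i` of cells in the pieces of a partition, at
scale `n`. -/
lemma IsIcoPartition.exists_quantizer_scale {ι : Type*} [Countable ι] {u v : ι → ℝ}
    (hp : IsIcoPartition u v) {r α : ℝ} (hr : 0 < r)
    (hα₀ : 0 < α) (hα₁ : α < 1) {h : ℝ → ℝ≥0∞} (hh : Measurable h) (M : ι → ℝ≥0∞)
    (hM : ∀ i, ∀ x ∈ Set.Ico (u i) (v i), h x ≤ M i) (ρ : ι → ℝ≥0∞) (hρ₀ : ∀ i, ρ i ≠ 0)
    (hρ : ∀ i, ρ i ≠ ∞) {n : ℝ≥0∞} (hn₀ : n ≠ 0) (hn : n ≠ ∞) :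
    ∃ q, IsQuantizer q ∧
      powerSum α (volume.withDensity h) q ≤
        n ^ (1 - α) * ∑' i, ρ i ^ (1 - α) * (volume.withDensity h) (Set.Ico (u i) (v i)) ^ α +
          ∑' i, (volume.withDensity h) (Set.Ico (u i) (v i)) ^ α ∧
      distortion r (volume.withDensity h) q ≤
        (n ^ r)⁻¹ * ∑' i, (ENNReal.ofReal (v i - u i) / ρ i) ^ r *
          min ((volume.withDensity h) (Set.Ico (u i) (v i)))
            (ENNReal.ofReal (ballConst r) * M i * ENNReal.ofReal (v i - u i)) := by
  have hpos : ∀ i, 0 < (n * ρ i).toReal := fun i =>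
    ENNReal.toReal_pos (mul_ne_zero hn₀ (hρ₀ i)) (ENNReal.mul_ne_top hn (hρ i))
  have hcast : ∀ i, ENNReal.ofReal (n * ρ i).toReal = n * ρ i := fun i =>
    ENNReal.ofReal_toReal (ENNReal.mul_ne_top hn (hρ i))
  have hle : ∀ i, n * ρ i ≤ (⌈(n * ρ i).toReal⌉₊ : ℝ≥0∞) := fun i => by
    rw [← ENNReal.ofReal_natCast, ← hcast i]
    exact ENNReal.ofReal_le_ofReal (by rw [hcast i]; exact Nat.le_ceil _)
  have hge : ∀ i, (⌈(n * ρ i).toReal⌉₊ : ℝ≥0∞) ≤ n * ρ i + 1 := fun i => by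
    rw [← ENNReal.ofReal_natCast, ← hcast i, ← ENNReal.ofReal_one,
      ← ENNReal.ofReal_add (hpos i).le zero_le_one]
    exact ENNReal.ofReal_le_ofReal (by rw [hcast i]; exact (Nat.ceil_lt_add_one (hpos i).le).le)
  obtain ⟨q, hq, hS, hD⟩ := hp.exists_quantizer_subdivide (fun i => ⌈(n * ρ i).toReal⌉₊)
    (fun i => Nat.ceil_pos.2 (hpos i)) hr hα₀ hα₁ hh M hM
  refine ⟨q, hq, hS.trans ?_, hD.trans ?_⟩
  · rw [← ENNReal.tsum_mul_left, ← ENNReal.tsum_add]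
    refine ENNReal.tsum_le_tsum fun i => ?_
    -- Subadditivity of `x ^ (1 - α)` splits off the rounding error, which becomes a second sum
    -- independent of `n`.
    have h1 : (⌈(n * ρ i).toReal⌉₊ : ℝ≥0∞) ^ (1 - α) ≤ n ^ (1 - α) * ρ i ^ (1 - α) + 1 := by
      refine (ENNReal.rpow_le_rpow (hge i) (by linarith)).trans ?_
      refine (ENNReal.rpow_add_le_add_rpow _ _ (by linarith) (by linarith)).trans_eq ?_
      rw [ENNReal.mul_rpow_of_nonneg _ _ (by linarith), ENNReal.one_rpow]
    refine (mul_le_mul_left h1 _).trans_eq ?_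
    ring
  · rw [← ENNReal.tsum_mul_left]
    refine ENNReal.tsum_le_tsum fun i => ?_
    rw [← mul_assoc]
    gcongr
    rw [← ENNReal.inv_rpow, ← ENNReal.mul_rpow_of_nonneg _ _ hr.le]
    gcongr
    calc ENNReal.ofReal (v i - u i) / _ ≤ ENNReal.ofReal (v i - u i) / (n * ρ i) := by
          gcongr; exact hle i
      _ = _ := by
        rw [div_eq_mul_inv, div_eq_mul_inv, ENNReal.mul_inv (Or.inl hn₀) (Or.inl hn)]
        ring

/-! ### The mesh with dyadic tails -/

/-- Index set of the partition of the line into a uniform mesh of width `1 / L` on `[-T, T)` and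
dyadic shells outside. -/
abbrev MeshIndex (T L : ℕ) : Type :=
  (Finset.Ico (-((T * L : ℕ) : ℤ)) ((T * L : ℕ) : ℤ)) ⊕ (ℕ ⊕ ℕ)

/-- Left endpoints of the mesh with dyadic tails. -/
noncomputable def meshLeft (T L : ℕ) : MeshIndex T L → ℝ :=
  Sum.elim (fun j => ((j : ℤ) : ℝ) / L)
    (Sum.elim (fun k => T * 2 ^ k) (fun k => -(T * 2 ^ (k + 1))))

/-- Right endpoints of the mesh with dyadic tails. -/
noncomputable def meshRight (T L : ℕ) : MeshIndex T L → ℝ :=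
  Sum.elim (fun j => (((j : ℤ) : ℝ) + 1) / L)
    (Sum.elim (fun k => T * 2 ^ (k + 1)) (fun k => -(T * 2 ^ k)))

/-- The cell number `j` of the mesh of width `1 / L`. -/
def meshCell (L : ℕ) (j : ℤ) : Set ℝ := Set.Ico ((j : ℝ) / L) ((j + 1 : ℝ) / L)

lemma mem_meshCell_iff {L : ℕ} (hL : 0 < L) {j : ℤ} {x : ℝ} :
    x ∈ meshCell L j ↔ ⌊(L : ℝ) * x⌋ = j := by
  have hL' : (0 : ℝ) < L := by exact_mod_cast hL
  rw [Int.floor_eq_iff, meshCell, Set.mem_Ico, div_le_iff₀ hL', lt_div_iff₀ hL', mul_comm]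

lemma floor_mem_Ico_iff {T L : ℕ} (hL : 0 < L) {x : ℝ} :
    ⌊(L : ℝ) * x⌋ ∈ Finset.Ico (-((T * L : ℕ) : ℤ)) ((T * L : ℕ) : ℤ) ↔
      x ∈ Set.Ico (-(T : ℝ)) T := by
  have hL' : (0 : ℝ) < L := by exact_mod_cast hL
  rw [Finset.mem_Ico, Int.le_floor, Int.floor_lt, Set.mem_Ico]
  push_cast
  constructor
  · rintro ⟨h1, h2⟩
    constructor <;> nlinarith
  · rintro ⟨h1, h2⟩
    constructor <;> nlinarith

lemma dyadic_unique {T : ℝ} (hT : 0 < T) {k l : ℕ} {x : ℝ} (h1 : T * 2 ^ k ≤ x)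
    (h2 : x < T * 2 ^ (l + 1)) : k < l + 1 := by
  have : T * (2 : ℝ) ^ k < T * 2 ^ (l + 1) := h1.trans_lt h2
  exact (pow_lt_pow_iff_right₀ (one_lt_two (α := ℝ))).1 (lt_of_mul_lt_mul_left this hT.le)

lemma dyadic_unique' {T : ℝ} (hT : 0 < T) {k l : ℕ} {x : ℝ} (h1 : T * 2 ^ k < x)
    (h2 : x ≤ T * 2 ^ (l + 1)) : k < l + 1 := by
  have : T * (2 : ℝ) ^ k < T * 2 ^ (l + 1) := h1.trans_le h2
  exact (pow_lt_pow_iff_right₀ (one_lt_two (α := ℝ))).1 (lt_of_mul_lt_mul_left this hT.le)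

lemma isIcoPartition_mesh {T L : ℕ} (hT : 0 < T) (hL : 0 < L) :
    IsIcoPartition (meshLeft T L) (meshRight T L) := by
  have hT' : (0 : ℝ) < T := by exact_mod_cast hT
  have hL' : (0 : ℝ) < L := by exact_mod_cast hL
  have hpow : ∀ k : ℕ, (T : ℝ) ≤ T * 2 ^ k := fun k =>
    le_mul_of_one_le_right hT'.le (one_le_pow₀ one_le_two)
  have hcore : ∀ (j : Finset.Ico (-((T * L : ℕ) : ℤ)) ((T * L : ℕ) : ℤ)) (x : ℝ),
      x ∈ Set.Ico (meshLeft T L (Sum.inl j)) (meshRight T L (Sum.inl j)) →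
        ⌊(L : ℝ) * x⌋ = j ∧ -(T : ℝ) ≤ x ∧ x < T := by
    intro j x hx
    have h1 : ⌊(L : ℝ) * x⌋ = j := (mem_meshCell_iff hL).1 hx
    exact ⟨h1, (floor_mem_Ico_iff hL).1 (h1 ▸ j.2)⟩
  refine ⟨?_, fun x => ?_, ?_⟩
  · rintro (j | k | k)
    · exact div_lt_div_of_pos_right (by linarith) hL'
    · exact mul_lt_mul_of_pos_left (pow_lt_pow_right₀ one_lt_two (Nat.lt_succ_self k)) hT'
    · exact neg_lt_neg (mul_lt_mul_of_pos_left (pow_lt_pow_right₀ one_lt_two (Nat.lt_succ_self k)) hT')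
  · by_cases hx : x ∈ Set.Ico (-(T : ℝ)) T
    · exact ⟨Sum.inl ⟨_, (floor_mem_Ico_iff hL).2 hx⟩, (mem_meshCell_iff hL).2 rfl⟩
    by_cases hx1 : (T : ℝ) ≤ x
    · obtain ⟨k, hk1, hk2⟩ := exists_nat_pow_near ((one_le_div hT').2 hx1) (one_lt_two (α := ℝ))
      rw [le_div_iff₀' hT'] at hk1
      rw [div_lt_iff₀' hT'] at hk2
      exact ⟨Sum.inr (Sum.inl k), hk1, hk2⟩
    · have hx2 : x < -T := by
        by_contra! h
        exact hx ⟨h, not_le.1 hx1⟩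
      -- Under reflection a left shell becomes open at `T * 2 ^ k` and closed at `T * 2 ^ (k + 1)`,
      -- so the shell of `x` is found through the least such `k`.
      have hex : ∃ k : ℕ, -x ≤ T * 2 ^ (k + 1) := by
        obtain ⟨k, hk⟩ := pow_unbounded_of_one_lt (-x / T) (one_lt_two (α := ℝ))
        rw [div_lt_iff₀' hT'] at hk
        exact ⟨k, hk.le.trans
          (mul_le_mul_of_nonneg_left (pow_le_pow_right₀ one_le_two k.le_succ) hT'.le)⟩
      classical
      refine ⟨Sum.inr (Sum.inr (Nat.find hex)), ?_, ?_⟩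
      · have := Nat.find_spec hex
        simp only [meshLeft, Sum.elim_inr]
        linarith
      · simp only [meshRight, Sum.elim_inr]
        rcases hk : Nat.find hex with _ | k
        · simpa using hx2
        · have := Nat.find_min hex (m := k) (by omega)
          linarith
  · rintro x (j | k | k) (j' | k' | k') ⟨h1, h2⟩ ⟨h3, h4⟩
    · exact congrArg Sum.inl (Subtype.ext ((hcore j x ⟨h1, h2⟩).1.symm.trans (hcore j' x ⟨h3, h4⟩).1))
    · have := hcore j x ⟨h1, h2⟩
      have := hpow k'
      simp only [meshLeft, Sum.elim_inr, Sum.elim_inl] at h3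
      linarith
    · have := hcore j x ⟨h1, h2⟩
      have := hpow k'
      simp only [meshRight, Sum.elim_inr] at h4
      linarith
    · have := hcore j' x ⟨h3, h4⟩
      have := hpow k
      simp only [meshLeft, Sum.elim_inr, Sum.elim_inl] at h1
      linarith
    · simp only [meshLeft, meshRight, Sum.elim_inr, Sum.elim_inl] at h1 h2 h3 h4
      have e1 := dyadic_unique hT' h1 h4
      have e2 := dyadic_unique hT' h3 h2
      rw [show k = k' by omega]
    · have := hpow k
      have := hpow k'
      simp only [meshLeft, meshRight, Sum.elim_inr, Sum.elim_inl] at h1 h2 h3 h4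
      linarith
    · have := hcore j' x ⟨h3, h4⟩
      have := hpow k
      simp only [meshRight, Sum.elim_inr] at h2
      linarith
    · have := hpow k
      have := hpow k'
      simp only [meshLeft, meshRight, Sum.elim_inr, Sum.elim_inl] at h1 h2 h3 h4
      linarith
    · simp only [meshLeft, meshRight, Sum.elim_inr] at h1 h2 h3 h4
      have e1 := dyadic_unique' (x := -x) hT' (by linarith) (l := k') (k := k) (by linarith)
      have e2 := dyadic_unique' (x := -x) hT' (by linarith) (l := k) (k := k') (by linarith)
      rw [show k = k' by omega]

/-- Local upper bound for `h` on the scale `1 / L`. -/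
noncomputable def localSup (h : ℝ → ℝ≥0∞) (L : ℕ) (x : ℝ) : ℝ≥0∞ :=
  ⨆ y ∈ meshCell L ⌊L * x⌋, h y

lemma measurable_localSup (h : ℝ → ℝ≥0∞) (L : ℕ) : Measurable (localSup h L) :=
  (measurable_of_countable (fun j : ℤ => ⨆ y ∈ meshCell L j, h y)).comp
    (Int.measurable_floor.comp (measurable_const_mul _))

lemma tendsto_localSup {h : ℝ → ℝ≥0∞} {x : ℝ} (hx : ContinuousAt h x) :
    Tendsto (fun n : ℕ => localSup h (n + 1) x) atTop (𝓝 (h x)) := by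
  refine tendsto_order.2 ⟨fun a ha => Eventually.of_forall fun n => ?_, fun a ha => ?_⟩
  · exact ha.trans_le (le_iSup₂ (f := fun y _ => h y) x ((mem_meshCell_iff n.succ_pos).2 rfl))
  · obtain ⟨b, hb1, hb2⟩ := exists_between ha
    obtain ⟨ε, hε, hball⟩ := Metric.mem_nhds_iff.1 (hx.eventually (gt_mem_nhds hb1))
    have h1 : ∀ᶠ n : ℕ in atTop, (1 : ℝ) / (n + 1 : ℕ) < ε :=
      ((tendsto_const_div_atTop_nhds_zero_nat (1 : ℝ)).comp (tendsto_add_atTop_nat 1)).eventually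
        (gt_mem_nhds hε)
    filter_upwards [h1] with n hn
    refine lt_of_le_of_lt (iSup₂_le fun y hy => (hball ?_ : h y < b).le) hb2
    have hL' : (0 : ℝ) < (n + 1 : ℕ) := by positivity
    have e1 := Int.floor_le (((n + 1 : ℕ) : ℝ) * x)
    have e2 := Int.lt_floor_add_one (((n + 1 : ℕ) : ℝ) * x)
    have e3 := hy.1
    have e4 := hy.2
    rw [div_le_iff₀ hL'] at e3
    rw [lt_div_iff₀ hL'] at e4
    rw [div_lt_iff₀ hL'] at hn
    rw [Metric.mem_ball, Real.dist_eq, abs_lt]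
    constructor <;> nlinarith

/-- Writes upper sums over the mesh as integrals, to which dominated convergence applies as `L → ∞`.
-/
lemma setLIntegral_Ico_comp_floor {T L : ℕ} (hL : 0 < L) (F : ℤ → ℝ≥0∞) :
    ∫⁻ x in Set.Ico (-(T : ℝ)) T, F ⌊(L : ℝ) * x⌋ =
      ∑' j : Finset.Ico (-((T * L : ℕ) : ℤ)) ((T * L : ℕ) : ℤ), F j * ENNReal.ofReal (1 / L) := by
  have h1 : Set.Ico (-(T : ℝ)) T =
      ⋃ j ∈ Finset.Ico (-((T * L : ℕ) : ℤ)) ((T * L : ℕ) : ℤ), meshCell L j := by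
    ext x
    simp only [Set.mem_iUnion, mem_meshCell_iff hL, exists_prop, exists_eq_right',
      floor_mem_Ico_iff hL]
  rw [h1, lintegral_biUnion_finset, Finset.tsum_subtype (f := fun j => F j * ENNReal.ofReal (1 / L))]
  · refine Finset.sum_congr rfl fun j _ => ?_
    rw [setLIntegral_congr_fun (s := meshCell L j) (g := fun _ => F j) measurableSet_Ico fun x hx =>
      congrArg F ((mem_meshCell_iff hL).1 hx), setLIntegral_const, meshCell, Real.volume_Ico]
    congr 2; ring
  · intro i _ j _ hij
    refine Set.disjoint_left.2 fun x hx hx' => hij ?_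
    rw [← (mem_meshCell_iff hL).1 hx, (mem_meshCell_iff hL).1 hx']
  · exact fun _ _ => measurableSet_Ico

/-- Sum of negative powers of dyadic endpoints. -/
noncomputable def dyadicSum (T : ℕ) (p : ℝ) : ℝ≥0∞ := ∑' k : ℕ, (((T : ℝ≥0∞) * 2 ^ k)⁻¹) ^ p

lemma dyadicSum_eq {T : ℕ} {p : ℝ} (hp : 0 < p) :
    dyadicSum T p = ((T : ℝ≥0∞)⁻¹) ^ p * (1 - (2⁻¹ : ℝ≥0∞) ^ p)⁻¹ := by
  rw [dyadicSum, ← ENNReal.tsum_geometric, ← ENNReal.tsum_mul_left]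
  refine tsum_congr fun k => ?_
  rw [ENNReal.mul_inv (Or.inr (by simp)) (Or.inr (by simp)), ENNReal.mul_rpow_of_nonneg _ _ hp.le,
    ENNReal.inv_pow, ← ENNReal.rpow_natCast, ← ENNReal.rpow_natCast, ← ENNReal.rpow_mul,
    ← ENNReal.rpow_mul, mul_comm p]

lemma geometric_ne_top {p : ℝ} (hp : 0 < p) : (1 - (2⁻¹ : ℝ≥0∞) ^ p)⁻¹ ≠ ∞ := by
  rw [ENNReal.inv_ne_top]
  have : (2⁻¹ : ℝ≥0∞) ^ p < 1 := ENNReal.rpow_lt_one (by simp) hp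
  exact (tsub_pos_of_lt this).ne'

lemma dyadicSum_ne_top {T : ℕ} (hT : 0 < T) {p : ℝ} (hp : 0 < p) : dyadicSum T p ≠ ∞ := by
  rw [dyadicSum_eq hp]
  refine ENNReal.mul_ne_top (ENNReal.rpow_ne_top_of_nonneg hp.le ?_) (geometric_ne_top hp)
  simpa using hT.ne'

lemma tendsto_dyadicSum {p : ℝ} (hp : 0 < p) :
    Tendsto (fun T => dyadicSum T p) atTop (𝓝 0) := by
  have h1 : Tendsto (fun T : ℕ => ((T : ℝ≥0∞)⁻¹) ^ p) atTop (𝓝 0) := by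
    have := (ENNReal.continuous_rpow_const (y := p)).tendsto 0 |>.comp
      ENNReal.tendsto_inv_nat_nhds_zero
    simpa [Function.comp_def, ENNReal.zero_rpow_of_pos hp] using this
  have h2 := ENNReal.Tendsto.mul_const h1 (b := (1 - (2⁻¹ : ℝ≥0∞) ^ p)⁻¹)
    (Or.inr (geometric_ne_top hp))
  rw [zero_mul] at h2
  exact h2.congr fun T => (dyadicSum_eq hp).symm

/-- Markov's inequality on a set bounded away from the origin. -/
lemma measure_le_inv_rpow_mul {ν : Measure ℝ} {p : ℝ} (hp : 0 < p) {J : Set ℝ} {R : ℝ} (hR : 0 < R) (hJR : ∀ x ∈ J, R ≤ |x|) :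
    ν J ≤ ((ENNReal.ofReal R)⁻¹) ^ p * ∫⁻ x, ENNReal.ofReal (|x| ^ p) ∂ν := by
  have h0 : ENNReal.ofReal R ≠ 0 := by simpa using hR
  rw [ENNReal.inv_rpow, ← ENNReal.mul_le_iff_le_inv (ENNReal.rpow_pos (by simpa) (by simp)).ne'
    (ENNReal.rpow_ne_top_of_nonneg hp.le ENNReal.ofReal_ne_top), ← setLIntegral_const]
  refine le_trans ?_ (setLIntegral_le_lintegral J _)
  refine setLIntegral_mono (by fun_prop) fun x hx => ?_
  rw [ENNReal.ofReal_rpow_of_nonneg hR.le hp.le]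
  have := hJR x hx
  gcongr

/-! ### The upper bound -/

/-- With relative cell number `a * m ^ ((1 - α) / (1 - α + r))` on a piece of length `a` and density
bound `m`, the power sum and, by the next lemma, the distortion divided by `C` both receive the term
`m ^ β₁ * a`. This is the equality case of Hölder. -/
lemma scale_power_identity {r α : ℝ} (hr : 0 < r) (hα₀ : 0 < α) (hα₁ : α < 1) (a m : ℝ≥0∞) :
    (a * m ^ ((1 - α) / (1 - α + r))) ^ (1 - α) * (m * a) ^ α = m ^ betaOne r α * a := by
  have h1 : 0 < 1 - α := by linarith
  have h2 : (1 - α) / (1 - α + r) * (1 - α) + α = betaOne r α := by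
    unfold betaOne; field_simp; ring
  have h3 : a = a ^ (1 - α) * a ^ α := by
    rw [← ENNReal.rpow_add_of_nonneg _ _ h1.le hα₀.le, sub_add_cancel, ENNReal.rpow_one]
  rw [ENNReal.mul_rpow_of_nonneg _ _ h1.le, ENNReal.mul_rpow_of_nonneg _ _ hα₀.le,
    ← ENNReal.rpow_mul, ← h2, ENNReal.rpow_add_of_nonneg _ _ (by positivity) hα₀.le]
  nth_rewrite 3 [h3]
  ring

lemma scale_distortion_identity {r α : ℝ} (hr : 0 < r) (hα₁ : α < 1) {a m : ℝ≥0∞}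
    (ha₀ : a ≠ 0) (ha : a ≠ ∞) (hm₀ : m ≠ 0) (hm : m ≠ ∞) :
    (a / (a * m ^ ((1 - α) / (1 - α + r)))) ^ r * m = m ^ betaOne r α := by
  have h1 : 0 < 1 - α := by linarith
  have h2 : -((1 - α) / (1 - α + r)) * r + 1 = betaOne r α := by
    unfold betaOne; field_simp; ring
  have h3 : a / (a * m ^ ((1 - α) / (1 - α + r))) = m ^ (-((1 - α) / (1 - α + r))) := by
    rw [div_eq_mul_inv, ENNReal.mul_inv (Or.inl ha₀) (Or.inl ha), ← mul_assoc,
      ENNReal.mul_inv_cancel ha₀ ha, one_mul, ENNReal.rpow_neg]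
  rw [h3, ← ENNReal.rpow_mul]
  nth_rewrite 2 [← ENNReal.rpow_one m]
  rw [← ENNReal.rpow_add _ _ hm₀ hm, h2]

lemma tsum_sum_sum {A B C : Type*} (f : A ⊕ (B ⊕ C) → ℝ≥0∞) :
    ∑' i, f i = ∑' a, f (.inl a) + (∑' b, f (.inr (.inl b)) + ∑' c, f (.inr (.inr c))) := by
  rw [Summable.tsum_sum ENNReal.summable ENNReal.summable,
    Summable.tsum_sum (f := fun x => f (.inr x)) ENNReal.summable ENNReal.summable]

/-- Upper estimate of the normalized power sums and distortions of the quantizers built on the mesh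
of width `1 / L` on `[-T, T)` with dyadic tails. -/
noncomputable def meshBound (r α p : ℝ) (h : ℝ → ℝ≥0∞) (m : ℝ≥0∞) (T L : ℕ) : ℝ≥0∞ :=
  (∫⁻ x in Set.Ico (-(T : ℝ)) T, (localSup h L x + ENNReal.ofReal (1 / L)) ^ betaOne r α) +
    (2 * (m ^ α * dyadicSum T (p * α)) +
      (ENNReal.ofReal (ballConst r))⁻¹ * (2 * (m * dyadicSum T (p - r))))

/-- The same number bounds the normalized power sum and the normalized distortion, since core terms
agree and `meshBound` contains both tails. `V` collects the rounding errors and does not grow with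
`n`. -/
lemma exists_quantizer_meshBound {r α p : ℝ} (hr : 0 < r) (hp : r < p) (hα₀ : 0 < α) (hα₁ : α < 1)
    {h : ℝ → ℝ≥0∞} (hh : Measurable h) {B : ℝ≥0∞} (hB : B ≠ ∞) (hhB : ∀ x, h x ≤ B)
    (hmom : ∫⁻ x, ENNReal.ofReal (|x| ^ p) ∂(volume.withDensity h) ≠ ∞) {T L : ℕ} (hT : 0 < T)
    (hL : 0 < L) :
    ∃ V : ℝ≥0∞, V ≠ ∞ ∧ ∀ n : ℝ≥0∞, n ≠ 0 → n ≠ ∞ → ∃ q, IsQuantizer q ∧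
      powerSum α (volume.withDensity h) q ≤ n ^ (1 - α) *
        meshBound r α p h (∫⁻ x, ENNReal.ofReal (|x| ^ p) ∂(volume.withDensity h)) T L + V ∧
      distortion r (volume.withDensity h) q ≤ (n ^ r)⁻¹ * (ENNReal.ofReal (ballConst r) *
        meshBound r α p h (∫⁻ x, ENNReal.ofReal (|x| ^ p) ∂(volume.withDensity h)) T L) := by
  set ν := volume.withDensity h with hν
  set Mom := ∫⁻ x, ENNReal.ofReal (|x| ^ p) ∂ν
  have hT' : (0 : ℝ) < T := by exact_mod_cast hT
  have hL' : (0 : ℝ) < L := by exact_mod_cast hL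
  have h1 : 0 < 1 - α := by linarith
  have hp0 : 0 < p := hr.trans hp
  have hC : ENNReal.ofReal (ballConst r) ≠ 0 := by simpa using ballConst_pos hr
  set a := ENNReal.ofReal (1 / (L : ℝ)) with ha
  have ha₀ : a ≠ 0 := by simpa [ha] using hL.ne'
  have hatop : a ≠ ∞ := ENNReal.ofReal_ne_top
  -- Adding `a` keeps `m j` nonzero where `h` vanishes; it disappears as `L → ∞`.
  let m : ℤ → ℝ≥0∞ := fun j => (⨆ y ∈ meshCell L j, h y) + a
  have hm₀ : ∀ j, m j ≠ 0 := fun j => by simp [m, ha₀]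
  have hm : ∀ j, m j ≠ ∞ := fun j =>
    ENNReal.add_ne_top.2 ⟨ne_top_of_le_ne_top hB (iSup₂_le fun y _ => hhB y), hatop⟩
  have hhm : ∀ j, ∀ x ∈ meshCell L j, h x ≤ m j := fun j x hx =>
    (le_iSup₂ (f := fun y _ => h y) x hx).trans le_self_add
  set u := meshLeft T L with hu
  set v := meshRight T L with hv
  have hpart : IsIcoPartition u v := isIcoPartition_mesh hT hL
  have hlen : ∀ j, ENNReal.ofReal (v (.inl j) - u (.inl j)) = a := fun j => by
    rw [ha]; congr 1; simp only [hu, hv, meshLeft, meshRight, Sum.elim_inl]; ring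
  have hP : ∀ j, ν (Set.Ico (u (.inl j)) (v (.inl j))) ≤ m j * a := fun j => by
    rw [hν, withDensity_apply _ measurableSet_Ico]
    refine (setLIntegral_mono measurable_const (g := fun _ => m j) fun x hx => hhm j x hx).trans_eq ?_
    rw [← hlen j, ← Real.volume_Ico]
    exact setLIntegral_const _ _
  have hdy : ∀ k : ℕ, ENNReal.ofReal (T * 2 ^ k) = (T : ℝ≥0∞) * 2 ^ k := fun k => by
    rw [ENNReal.ofReal_mul hT'.le, ENNReal.ofReal_natCast, ENNReal.ofReal_pow zero_le_two]
    simp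
  have hPr : ∀ k, ν (Set.Ico (u (.inr (.inl k))) (v (.inr (.inl k)))) ≤
      (((T : ℝ≥0∞) * 2 ^ k)⁻¹) ^ p * Mom := fun k => by
    rw [← hdy k]
    exact measure_le_inv_rpow_mul hp0 (by positivity) fun x hx => hx.1.trans (le_abs_self x)
  have hPl : ∀ k, ν (Set.Ico (u (.inr (.inr k))) (v (.inr (.inr k)))) ≤
      (((T : ℝ≥0∞) * 2 ^ k)⁻¹) ^ p * Mom := fun k => by
    rw [← hdy k]
    refine measure_le_inv_rpow_mul hp0 (by positivity) fun x hx => ?_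
    have : x < -(T * 2 ^ k) := hx.2
    exact (by linarith : (T : ℝ) * 2 ^ k ≤ -x).trans (neg_le_abs x)
  have hlr : ∀ k, ENNReal.ofReal (v (.inr (.inl k)) - u (.inr (.inl k))) = (T : ℝ≥0∞) * 2 ^ k :=
    fun k => by
      rw [← hdy]; congr 1; simp only [hu, hv, meshLeft, meshRight, Sum.elim_inl, Sum.elim_inr]; ring
  have hll : ∀ k, ENNReal.ofReal (v (.inr (.inr k)) - u (.inr (.inr k))) = (T : ℝ≥0∞) * 2 ^ k :=
    fun k => by
      rw [← hdy]; congr 1; simp only [hu, hv, meshLeft, meshRight, Sum.elim_inr]; ring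
  have hSP : ∀ k : ℕ, ∀ P ≤ (((T : ℝ≥0∞) * 2 ^ k)⁻¹) ^ p * Mom,
      P ^ α ≤ Mom ^ α * (((T : ℝ≥0∞) * 2 ^ k)⁻¹) ^ (p * α) := fun k P hP => by
    refine (ENNReal.rpow_le_rpow hP hα₀.le).trans_eq ?_
    rw [ENNReal.mul_rpow_of_nonneg _ _ hα₀.le, ← ENNReal.rpow_mul, mul_comm]
  have hDP : ∀ k : ℕ, ∀ P ≤ (((T : ℝ≥0∞) * 2 ^ k)⁻¹) ^ p * Mom,
      ((T : ℝ≥0∞) * 2 ^ k) ^ r * P ≤ Mom * (((T : ℝ≥0∞) * 2 ^ k)⁻¹) ^ (p - r) := fun k P hP => by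
    have hx₀ : (T : ℝ≥0∞) * 2 ^ k ≠ 0 := by simp [hT.ne']
    have hx : (T : ℝ≥0∞) * 2 ^ k ≠ ∞ :=
      ENNReal.mul_ne_top (ENNReal.natCast_ne_top _) (ENNReal.pow_ne_top (by simp))
    refine (mul_le_mul_right hP _).trans_eq ?_
    rw [ENNReal.inv_rpow, ENNReal.inv_rpow, ← ENNReal.rpow_neg, ← ENNReal.rpow_neg, ← mul_assoc,
      ← ENNReal.rpow_add _ _ hx₀ hx, mul_comm]
    congr 2; ring
  have hcore : ∫⁻ x in Set.Ico (-(T : ℝ)) T, (localSup h L x + a) ^ betaOne r α =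
      ∑' j : Finset.Ico (-((T * L : ℕ) : ℤ)) ((T * L : ℕ) : ℤ), m j ^ betaOne r α * a :=
    setLIntegral_Ico_comp_floor hL fun j => m j ^ betaOne r α
  refine ⟨∑' i, ν (Set.Ico (u i) (v i)) ^ α, ?_, fun n hn₀ hn => ?_⟩
  · rw [tsum_sum_sum]
    refine ENNReal.add_ne_top.2 ⟨?_, ENNReal.add_ne_top.2 ⟨?_, ?_⟩⟩
    · rw [tsum_fintype]
      exact ENNReal.sum_ne_top.2 fun j _ => ENNReal.rpow_ne_top_of_nonneg hα₀.le
        (ne_top_of_le_ne_top (ENNReal.mul_ne_top (hm j) hatop) (hP j))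
    · refine ne_top_of_le_ne_top ?_ (ENNReal.tsum_le_tsum fun k => hSP k _ (hPr k))
      rw [ENNReal.tsum_mul_left]
      exact ENNReal.mul_ne_top (ENNReal.rpow_ne_top_of_nonneg hα₀.le hmom)
        (dyadicSum_ne_top hT (by positivity))
    · refine ne_top_of_le_ne_top ?_ (ENNReal.tsum_le_tsum fun k => hSP k _ (hPl k))
      rw [ENNReal.tsum_mul_left]
      exact ENNReal.mul_ne_top (ENNReal.rpow_ne_top_of_nonneg hα₀.le hmom)
        (dyadicSum_ne_top hT (by positivity))
  · obtain ⟨q, hq, hS, hD⟩ := hpart.exists_quantizer_scale hr hα₀ hα₁ hh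
      -- No density bound is used on the shells: there the minimum is estimated by the mass, through
      -- Markov's inequality.
      (Sum.elim (fun j => m j) fun _ => ∞)
      (by rintro (j | k) x hx
          · exact hhm j x hx
          · exact le_top)
      (Sum.elim (fun j => a * m j ^ ((1 - α) / (1 - α + r))) fun _ => 1)
      (by rintro (j | k)
          · exact mul_ne_zero ha₀
              (ENNReal.rpow_pos (pos_iff_ne_zero.2 (hm₀ j)) (hm j)).ne'
          · exact one_ne_zero)
      (by rintro (j | k)
          · exact ENNReal.mul_ne_top hatop (ENNReal.rpow_ne_top_of_nonneg (by positivity) (hm j))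
          · exact ENNReal.one_ne_top) hn₀ hn
    refine ⟨q, hq, hS.trans ?_, hD.trans ?_⟩
    · gcongr
      rw [tsum_sum_sum, meshBound, hcore, two_mul]
      simp only [Sum.elim_inl, Sum.elim_inr, ENNReal.one_rpow, one_mul]
      refine add_le_add (ENNReal.tsum_le_tsum fun j => ?_) (le_add_right (add_le_add ?_ ?_))
      · rw [← scale_power_identity hr hα₀ hα₁]
        exact mul_le_mul_right (ENNReal.rpow_le_rpow (hP j) hα₀.le) _
      · rw [dyadicSum, ← ENNReal.tsum_mul_left]
        exact ENNReal.tsum_le_tsum fun k => hSP k _ (hPr k)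
      · rw [dyadicSum, ← ENNReal.tsum_mul_left]
        exact ENNReal.tsum_le_tsum fun k => hSP k _ (hPl k)
    · gcongr
      rw [tsum_sum_sum, meshBound, hcore, mul_add, mul_add, ← mul_assoc _ _ (2 * _),
        ENNReal.mul_inv_cancel hC ENNReal.ofReal_ne_top, one_mul, two_mul (Mom * _),
        ← ENNReal.tsum_mul_left]
      simp only [Sum.elim_inl, Sum.elim_inr, div_one, hlen, hlr, hll]
      refine add_le_add (ENNReal.tsum_le_tsum fun j => ?_) (le_add_left (add_le_add ?_ ?_))
      · rw [← scale_distortion_identity hr hα₁ ha₀ hatop (hm₀ j) (hm j)]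
        refine (mul_le_mul_right (min_le_right _ _) _).trans_eq ?_
        ring
      · rw [dyadicSum, ← ENNReal.tsum_mul_left]
        exact ENNReal.tsum_le_tsum fun k =>
          (mul_le_mul_right (min_le_left _ _) _).trans (hDP k _ (hPr k))
      · rw [dyadicSum, ← ENNReal.tsum_mul_left]
        exact ENNReal.tsum_le_tsum fun k =>
          (mul_le_mul_right (min_le_left _ _) _).trans (hDP k _ (hPl k))

/-- First `T` is taken large to make the tails small, which for the distortion requires `p > r`;
then `L` is chosen by dominated convergence on the bounded core. -/
lemma exists_meshBound_lt {r α p : ℝ} (hr : 0 < r) (hp : r < p) (hα₀ : 0 < α) (hα₁ : α < 1)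
    {h : ℝ → ℝ≥0∞} (hc : ∀ᵐ x, ContinuousAt h x) {B : ℝ≥0∞}
    (hB : B ≠ ∞) (hhB : ∀ x, h x ≤ B) {m : ℝ≥0∞} (hm : m ≠ ∞) {W : ℝ≥0∞}
    (hW : ∫⁻ x, h x ^ betaOne r α < W) :
    ∃ T L : ℕ, 0 < T ∧ 0 < L ∧ meshBound r α p h m T L < W := by
  have hβ := betaOne_pos hr hα₀ hα₁
  have hp0 : 0 < p := hr.trans hp
  have hC : ENNReal.ofReal (ballConst r) ≠ 0 := by simpa using ballConst_pos hr
  have htail : Tendsto (fun T : ℕ => (2 * (m ^ α * dyadicSum T (p * α)) +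
      (ENNReal.ofReal (ballConst r))⁻¹ * (2 * (m * dyadicSum T (p - r))))) atTop (𝓝 0) := by
    have e1 := ENNReal.Tendsto.const_mul (a := 2) (ENNReal.Tendsto.const_mul (a := m ^ α)
      (tendsto_dyadicSum (p := p * α) (by positivity))
      (Or.inr (ENNReal.rpow_ne_top_of_nonneg hα₀.le hm))) (Or.inr (by simp))
    have e2 := ENNReal.Tendsto.const_mul (a := (ENNReal.ofReal (ballConst r))⁻¹)
      (ENNReal.Tendsto.const_mul (a := 2) (ENNReal.Tendsto.const_mul (a := m)
      (tendsto_dyadicSum (p := p - r) (by linarith)) (Or.inr hm)) (Or.inr (by simp)))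
      (Or.inr (ENNReal.inv_ne_top.2 hC))
    simpa using e1.add e2
  have hdiff : 0 < W - ∫⁻ x, h x ^ betaOne r α := tsub_pos_of_lt hW
  obtain ⟨T, hT, hT0⟩ := ((htail.eventually (gt_mem_nhds hdiff)).and (eventually_gt_atTop 0)).exists
  have hlim : Tendsto (fun n : ℕ => ∫⁻ x in Set.Ico (-(T : ℝ)) T,
      (localSup h (n + 1) x + ENNReal.ofReal (1 / (n + 1 : ℕ))) ^ betaOne r α) atTop
      (𝓝 (∫⁻ x in Set.Ico (-(T : ℝ)) T, h x ^ betaOne r α)) := by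
    refine tendsto_lintegral_of_dominated_convergence (fun _ => (B + 1) ^ betaOne r α)
      (fun n => ((measurable_localSup h (n + 1)).add_const _).pow_const _)
      (fun n => Eventually.of_forall fun x => ?_) ?_ ?_
    · refine ENNReal.rpow_le_rpow (add_le_add (iSup₂_le fun y _ => hhB y) ?_) hβ.le
      rw [← ENNReal.ofReal_one]
      exact ENNReal.ofReal_le_ofReal ((div_le_one (by positivity)).2 (by norm_cast; omega))
    · rw [setLIntegral_const, Real.volume_Ico]
      exact ENNReal.mul_ne_top (ENNReal.rpow_ne_top_of_nonneg hβ.le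
        (ENNReal.add_ne_top.2 ⟨hB, by simp⟩)) ENNReal.ofReal_ne_top
    · refine ae_restrict_of_ae (hc.mono fun x hx => ?_)
      have e1 : Tendsto (fun n : ℕ => ENNReal.ofReal (1 / (n + 1 : ℕ))) atTop (𝓝 0) := by
        have := ((tendsto_const_div_atTop_nhds_zero_nat (1 : ℝ)).comp (tendsto_add_atTop_nat 1))
        simpa using ENNReal.tendsto_ofReal this
      have e2 := (tendsto_localSup hx).add e1
      rw [add_zero] at e2
      exact (ENNReal.continuous_rpow_const.tendsto _).comp e2
  have hlt : ∫⁻ x in Set.Ico (-(T : ℝ)) T, h x ^ betaOne r α <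
      W - (2 * (m ^ α * dyadicSum T (p * α)) +
      (ENNReal.ofReal (ballConst r))⁻¹ * (2 * (m * dyadicSum T (p - r)))) := by
    refine lt_of_le_of_lt (setLIntegral_le_lintegral _ _) ?_
    rw [lt_tsub_comm]
    exact hT
  obtain ⟨n, hn⟩ := (hlim.eventually (gt_mem_nhds hlt)).exists
  exact ⟨T, n + 1, hT0, n.succ_pos, lt_tsub_iff_right.1 hn⟩

/-- Existence of quantizers with given power sum and asymptotically least distortion. -/
theorem exists_quantizer_distortion_le {r α p : ℝ} (hr : 0 < r) (hp : r < p) (hα₀ : 0 < α)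
    (hα₁ : α < 1) {h : ℝ → ℝ≥0∞} (hh : Measurable h) (hc : ∀ᵐ x, ContinuousAt h x) {B : ℝ≥0∞}
    (hB : B ≠ ∞) (hhB : ∀ x, h x ≤ B)
    (hmom : ∫⁻ x, ENNReal.ofReal (|x| ^ p) ∂(volume.withDensity h) ≠ ∞) {W : ℝ≥0∞} (hWtop : W ≠ ∞)
    (hW : ∫⁻ x, h x ^ betaOne r α < W) :
    ∃ s₀ : ℝ≥0∞, s₀ ≠ ∞ ∧ ∀ s, s₀ ≤ s → s ≠ ∞ → ∃ q, IsQuantizer q ∧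
      powerSum α (volume.withDensity h) q ≤ s ∧
      distortion r (volume.withDensity h) q ≤
        ENNReal.ofReal (ballConst r) * W ^ betaTwo r α * (s ^ (r / (1 - α)))⁻¹ := by
  obtain ⟨T, L, hT, hL, hU⟩ := exists_meshBound_lt hr hp hα₀ hα₁ hc hB hhB hmom hW
  obtain ⟨V, hV, hq⟩ := exists_quantizer_meshBound hr hp hα₀ hα₁ hh hB hhB hmom hT hL
  set U := meshBound r α p h (∫⁻ x, ENNReal.ofReal (|x| ^ p) ∂(volume.withDensity h)) T L
  have h1 : 0 < 1 - α := by linarith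
  have ht : 0 < r / (1 - α) := by positivity
  have hW₀ : W ≠ 0 := (bot_lt_of_lt hW).ne'
  have hdiff : W - U ≠ 0 := (tsub_pos_of_lt hU).ne'
  -- The scale below satisfies `n ^ (1 - α) = s / W`, so the power sum is at most `(s / W) * U + V`,
  -- and this is at most `s` exactly when `V ≤ (s / W) * (W - U)`. The summand `1` keeps `s`
  -- nonzero.
  refine ⟨V / (W - U) * W + 1, ENNReal.add_ne_top.2 ⟨ENNReal.mul_ne_top
    (ENNReal.div_ne_top hV hdiff) hWtop, by simp⟩, fun s hs hs_fin => ?_⟩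
  have hs₀ : s ≠ 0 := fun h0 => by simp [h0] at hs
  have hsW₀ : s / W ≠ 0 := ENNReal.div_ne_zero.2 ⟨hs₀, hWtop⟩
  have hsW : s / W ≠ ∞ := ENNReal.div_ne_top hs_fin hW₀
  obtain ⟨q, hqq, hS, hD⟩ := hq ((s / W) ^ (1 - α)⁻¹)
    (ENNReal.rpow_pos (pos_iff_ne_zero.2 hsW₀) hsW).ne'
    (ENNReal.rpow_ne_top_of_nonneg (by positivity) hsW)
  refine ⟨q, hqq, hS.trans ?_, hD.trans ?_⟩
  · rw [← ENNReal.rpow_mul, inv_mul_cancel₀ h1.ne', ENNReal.rpow_one]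
    have hVle : V ≤ s / W * (W - U) := by
      have : V / (W - U) ≤ s / W := by
        rw [ENNReal.le_div_iff_mul_le (Or.inl hW₀) (Or.inl hWtop)]
        exact le_self_add.trans hs
      rwa [ENNReal.div_le_iff hdiff (ne_top_of_le_ne_top hWtop tsub_le_self)] at this
    calc s / W * U + V ≤ s / W * U + s / W * (W - U) := by gcongr
      _ = s := by
        rw [← mul_add, add_tsub_cancel_of_le hU.le, ENNReal.div_mul_cancel hW₀ hWtop]
  · rw [← ENNReal.rpow_mul, inv_mul_eq_div, betaTwo_eq hα₁,
      ENNReal.rpow_add_of_nonneg _ _ zero_le_one ht.le, ENNReal.rpow_one,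
      ENNReal.div_rpow_of_nonneg _ _ ht.le, ENNReal.inv_div]
    · rw [div_eq_mul_inv]
      calc W ^ (r / (1 - α)) * (s ^ (r / (1 - α)))⁻¹ * (ENNReal.ofReal (ballConst r) * U)
          ≤ W ^ (r / (1 - α)) * (s ^ (r / (1 - α)))⁻¹ * (ENNReal.ofReal (ballConst r) * W) := by
            gcongr
        _ = _ := by ring
    · exact Or.inl (ENNReal.rpow_ne_top_of_nonneg ht.le hWtop)
    · exact Or.inl (ENNReal.rpow_pos (pos_iff_ne_zero.2 hW₀) hWtop).ne'

/-! ### Finiteness of the integral and regularity of weakly unimodal densities -/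

/-- Hölder against the weight `(1 + |x|) ^ p`: one factor is a moment, the other an integral of `(1
+ |x|) ^ (-pβ / (1 - β))`, with `β = β₁`. It converges since `rβ / (1 - β) = 1 + αr / (1 - α) > 1`.
-/
lemma lintegral_rpow_betaOne_ne_top {r α p : ℝ} (hr : 0 < r) (hp : r < p) (hα₀ : 0 < α)
    (hα₁ : α < 1) {h : ℝ → ℝ≥0∞} (hh : Measurable h) (hfin : ∫⁻ x, h x ≠ ∞)
    (hmom : ∫⁻ x, ENNReal.ofReal (|x| ^ p) ∂(volume.withDensity h) ≠ ∞) :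
    ∫⁻ x, h x ^ betaOne r α ≠ ∞ := by
  have h1 : 0 < 1 - α := by linarith
  have hp0 : 0 < p := hr.trans hp
  have hβ := betaOne_pos hr hα₀ hα₁
  have hβ1 : 1 - betaOne r α = r * (1 - α) / (1 - α + r) := by
    unfold betaOne; field_simp; ring
  have hβ1' : 0 < 1 - betaOne r α := by rw [hβ1]; positivity
  set β := betaOne r α with hβdef
  have he : 1 < p * β / (1 - β) := by
    rw [lt_div_iff₀ hβ1', one_mul]
    refine lt_trans ?_ (mul_lt_mul_of_pos_right hp hβ)
    rw [hβ1, hβdef, betaOne, mul_div_assoc]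
    refine mul_lt_mul_of_pos_left (div_lt_div_of_pos_right ?_ (by linarith)) hr
    have : 0 < α * r := by positivity
    linarith
  have hw₀ : ∀ x : ℝ, ENNReal.ofReal (1 + |x|) ≠ 0 := fun x => by
    rw [ne_eq, ENNReal.ofReal_eq_zero, not_le]; positivity
  have key : ∀ x, h x ^ β = (h x * ENNReal.ofReal (1 + |x|) ^ p) ^ β *
      (ENNReal.ofReal (1 + |x|) ^ (-(p * β / (1 - β)))) ^ (1 - β) := by
    intro x
    rw [ENNReal.mul_rpow_of_nonneg _ _ hβ.le, ← ENNReal.rpow_mul, ← ENNReal.rpow_mul, mul_assoc,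
      ← ENNReal.rpow_add _ _ (hw₀ x) ENNReal.ofReal_ne_top,
      show p * β + -(p * β / (1 - β)) * (1 - β) = 0 by field_simp; ring, ENNReal.rpow_zero, mul_one]
  simp_rw [key]
  refine ne_top_of_le_ne_top ?_ (ENNReal.lintegral_mul_norm_pow_le (by fun_prop) (by fun_prop)
    hβ.le hβ1'.le (by ring))
  refine ENNReal.mul_ne_top (ENNReal.rpow_ne_top_of_nonneg hβ.le ?_)
    (ENNReal.rpow_ne_top_of_nonneg hβ1'.le ?_)
  · have hle : ∀ x, h x * ENNReal.ofReal (1 + |x|) ^ p ≤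
        2 ^ p * (h x + h x * ENNReal.ofReal (|x| ^ p)) := by
      intro x
      have : ENNReal.ofReal (1 + |x|) ^ p ≤ 2 ^ p * (1 + ENNReal.ofReal (|x| ^ p)) := by
        rcases le_total |x| 1 with hx | hx
        · calc ENNReal.ofReal (1 + |x|) ^ p ≤ 2 ^ p * 1 := by
                rw [mul_one]
                refine ENNReal.rpow_le_rpow (ENNReal.ofReal_le_of_le_toReal ?_) hp0.le
                norm_num; linarith
            _ ≤ _ := by gcongr; exact le_self_add
        · calc ENNReal.ofReal (1 + |x|) ^ p ≤ (2 * ENNReal.ofReal |x|) ^ p := by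
                gcongr
                rw [← ENNReal.ofReal_ofNat, ← ENNReal.ofReal_mul zero_le_two]
                exact ENNReal.ofReal_le_ofReal (by linarith)
            _ = 2 ^ p * ENNReal.ofReal (|x| ^ p) := by
                rw [ENNReal.mul_rpow_of_nonneg _ _ hp0.le,
                  ENNReal.ofReal_rpow_of_nonneg (abs_nonneg x) hp0.le]
            _ ≤ _ := by gcongr; exact le_add_self
      calc _ ≤ h x * (2 ^ p * (1 + ENNReal.ofReal (|x| ^ p))) := by gcongr
        _ = _ := by ring
    refine ne_top_of_le_ne_top ?_ (lintegral_mono hle)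
    rw [lintegral_withDensity_eq_lintegral_mul _ hh (by fun_prop)] at hmom
    rw [lintegral_const_mul _ (by fun_prop), lintegral_add_left hh]
    exact ENNReal.mul_ne_top (ENNReal.rpow_ne_top_of_nonneg hp0.le (by simp))
      (ENNReal.add_ne_top.2 ⟨hfin, hmom⟩)
  · have := finite_integral_one_add_norm (E := ℝ) (μ := volume) (r := p * β / (1 - β))
      (by simpa using he)
    refine ne_of_lt (lt_of_eq_of_lt (lintegral_congr fun x => ?_) this)
    rw [ENNReal.ofReal_rpow_of_pos (by positivity), Real.norm_eq_abs]

/-- Two points of positive density lie in a common superlevel set of small positive level, which is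
an interval. -/
lemma IsWeaklyUnimodal.ordConnected_pos {g : ℝ → ℝ} (hg : IsWeaklyUnimodal g) :
    {x | 0 < g x}.OrdConnected := by
  obtain ⟨l₀, hl₀, hl⟩ := hg.superlevel
  refine ⟨fun x hx y hy z hz => ?_⟩
  have hx' : 0 < g x := hx
  have hy' : 0 < g y := hy
  have hlpos : 0 < min (l₀ / 2) (min (g x) (g y)) := by positivity
  obtain ⟨a, b, -, hab⟩ := hl (min (l₀ / 2) (min (g x) (g y)))
    ⟨hlpos, (min_le_left _ _).trans_lt (by linarith)⟩
  have h1 : x ∈ Set.Icc a b := by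
    rw [← hab]; exact (min_le_right (l₀ / 2) _).trans (min_le_left (g x) (g y))
  have h2 : y ∈ Set.Icc a b := by
    rw [← hab]; exact (min_le_right (l₀ / 2) _).trans (min_le_right (g x) (g y))
  have h3 : z ∈ Set.Icc a b := ⟨h1.1.trans hz.1, hz.2.trans h2.2⟩
  rw [← hab] at h3
  exact hlpos.trans_le (Set.mem_ofPred_eq ▸ h3 :)

lemma interior_pos_subset_support {g : ℝ → ℝ} (hg : Measurable g) :
    interior {x | 0 < g x} ⊆ (densityMeasure g).support := by
  intro x hx
  rw [Measure.mem_support_iff_forall]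
  intro U hU
  rw [pos_iff_ne_zero, densityMeasure, ne_eq, withDensity_apply_eq_zero (by fun_prop)]
  intro h0
  have h1 : interior U ∩ interior {x | 0 < g x} ⊆ {x | ENNReal.ofReal (g x) ≠ 0} ∩ U := by
    rintro y ⟨hy1, hy2⟩
    have : y ∈ {x | 0 < g x} := interior_subset hy2
    have : 0 < g y := this
    exact ⟨by simpa using this, interior_subset hy1⟩
  exact ((isOpen_interior.inter isOpen_interior).measure_pos volume
    ⟨x, mem_interior_iff_mem_nhds.2 hU, hx⟩).ne' (measure_mono_null h1 h0)

/-- The set `{0 < g}` is an interval, so its frontier is null. Its interior is an open part of the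
support, and off its closure `g` vanishes locally. -/
lemma IsWeaklyUnimodal.ae_continuousAt {g : ℝ → ℝ} (hg : IsWeaklyUnimodal g) :
    ∀ᵐ x, ContinuousAt g x := by
  have h0 : volume (frontier {x | 0 < g x}) = 0 :=
    hg.ordConnected_pos.convex.addHaar_frontier volume
  filter_upwards [compl_mem_ae_iff.2 h0] with x hx
  by_cases hxi : x ∈ interior {x | 0 < g x}
  · exact (hg.continuousOn_support.mono (interior_pos_subset_support hg.measurable)).continuousAt
      (isOpen_interior.mem_nhds hxi)
  · have hxc : x ∉ closure {x | 0 < g x} := fun h => hx ⟨h, hxi⟩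
    have : g =ᶠ[𝓝 x] fun _ => 0 := by
      filter_upwards [isClosed_closure.isOpen_compl.mem_nhds hxc] with y hy
      have : ¬ 0 < g y := fun h => hy (subset_closure h)
      exact le_antisymm (not_lt.1 this) (hg.nonneg y)
    exact continuousAt_const.congr this.symm

lemma IsWeaklyUnimodal.exists_bound {g : ℝ → ℝ} (hg : IsWeaklyUnimodal g) :
    ∃ B, ∀ x, g x ≤ B := by
  obtain ⟨l₀, hl₀, hl⟩ := hg.superlevel
  obtain ⟨a, b, hab, hlev⟩ := hl (l₀ / 2) ⟨by positivity, by linarith⟩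
  obtain ⟨B, hB⟩ : ∃ B, ∀ x ∈ Set.Icc a b, g x ≤ B := by
    -- A one-point level set is not the closure of its interior, so it is treated apart.
    rcases hab.eq_or_lt with rfl | hab
    · exact ⟨g a, fun x hx => by rw [Set.Icc_self] at hx; rw [hx]⟩
    have h1 : Set.Ioo a b ⊆ interior {x | 0 < g x} := by
      refine interior_maximal (fun x hx => ?_) isOpen_Ioo
      have : x ∈ {x | l₀ / 2 ≤ g x} := hlev ▸ Set.Ioo_subset_Icc_self hx
      exact (by positivity : 0 < l₀ / 2).trans_le this
    have h2 : Set.Icc a b ⊆ (densityMeasure g).support := by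
      rw [← closure_Ioo hab.ne]
      exact Measure.isClosed_support.closure_subset_iff.2
        (h1.trans (interior_pos_subset_support hg.measurable))
    obtain ⟨B, hB⟩ := isCompact_Icc.bddAbove_image (hg.continuousOn_support.mono h2)
    exact ⟨B, fun x hx => hB (Set.mem_image_of_mem g hx)⟩
  refine ⟨max B (l₀ / 2), fun x => ?_⟩
  by_cases hx : x ∈ Set.Icc a b
  · exact (hB x hx).trans (le_max_left _ _)
  · rw [← hlev] at hx
    exact (not_le.1 hx).le.trans (le_max_right _ _)

/-! ### Stability in the two-term Hölder inequality -/

/-- The product is a weighted geometric mean of `√x * √y` and `y` with weights `2θ` and `1 - 2θ`.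
The weighted mean inequality for this pair falls short of `θx + (1 - θ)y` by exactly the square
term. -/
lemma refined_young_of_le_half {θ x y : ℝ} (h0 : 0 ≤ θ) (h1 : θ ≤ 1 / 2) (hx : 0 ≤ x)
    (hy : 0 ≤ y) :
    x ^ θ * y ^ (1 - θ) + θ * (√x - √y) ^ 2 ≤ θ * x + (1 - θ) * y := by
  have e : x ^ θ * y ^ (1 - θ) = (√x * √y) ^ (2 * θ) * y ^ (1 - 2 * θ) := by
    rw [← Real.sqrt_mul hx, Real.sqrt_eq_rpow, ← Real.rpow_mul (by positivity),
      show 1 / 2 * (2 * θ) = θ by ring, Real.mul_rpow hx hy, mul_assoc,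
      ← Real.rpow_add_of_nonneg hy h0 (by linarith)]
    congr 2; ring
  have h := Real.geom_mean_le_arith_mean2_weighted (w₁ := 2 * θ) (w₂ := 1 - 2 * θ)
    (p₁ := √x * √y) (p₂ := y) (by linarith) (by linarith) (by positivity) hy (by ring)
  rw [e]
  have hx2 := Real.sq_sqrt hx
  have hy2 := Real.sq_sqrt hy
  nlinarith

/-- Weighted arithmetic-geometric mean inequality with a quadratic remainder. -/
lemma refined_young {θ x y : ℝ} (h0 : 0 ≤ θ) (h1 : θ ≤ 1) (hx : 0 ≤ x) (hy : 0 ≤ y) :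
    x ^ θ * y ^ (1 - θ) + min θ (1 - θ) * (√x - √y) ^ 2 ≤ θ * x + (1 - θ) * y := by
  rcases le_total θ (1 / 2) with h | h
  · rw [min_eq_left (by linarith)]
    exact refined_young_of_le_half h0 h hx hy
  · rw [min_eq_right (by linarith)]
    have := refined_young_of_le_half (θ := 1 - θ) (by linarith) (by linarith) hy hx
    rw [sub_sub_cancel] at this
    nlinarith

/-- Stability of the equality case of Hölder's inequality for two summands. -/
lemma hoelder_stability {θ p ε x x' y y' : ℝ} (h0 : 0 < θ) (h1 : θ < 1) (hε₀ : 0 < ε) (hε : ε ≤ 1)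
    (hx : 0 ≤ x) (hx' : 0 ≤ x') (hy : 0 ≤ y) (hy' : 0 ≤ y') (hxx : x + x' ≤ 1 + ε)
    (hyy : y + y' ≤ 1 + ε) (hp : p - ε ≤ x ^ θ * y ^ (1 - θ))
    (hp' : 1 - p - ε ≤ x' ^ θ * y' ^ (1 - θ)) :
    |x - p| ≤ 2 * ε + √(24 * ε / min θ (1 - θ)) ∧
      |y - p| ≤ 2 * ε + 2 * √(24 * ε / min θ (1 - θ)) := by
  have hc : 0 < min θ (1 - θ) := lt_min h0 (by linarith)
  set c := min θ (1 - θ)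
  have y1 := refined_young h0.le h1.le hx hy
  have y2 := refined_young h0.le h1.le hx' hy'
  have n1 : 0 ≤ c * (√x - √y) ^ 2 := by positivity
  have n2 : 0 ≤ c * (√x' - √y') ^ 2 := by positivity
  have m1 : θ * (x + x') ≤ θ * (1 + ε) := mul_le_mul_of_nonneg_left hxx h0.le
  have m2 : (1 - θ) * (y + y') ≤ (1 - θ) * (1 + ε) := mul_le_mul_of_nonneg_left hyy (by linarith)
  -- The two Young inequalities have total slack at most `(1 + ε) - (1 - 2ε) = 3ε`, which bounds
  -- each remainder. The factor `8` is `2(u + v)` with `u, v ≤ 2`.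
  have b : ∀ u v : ℝ, 0 ≤ u → 0 ≤ v → u ≤ 2 → v ≤ 2 → c * (√u - √v) ^ 2 ≤ 3 * ε →
      |u - v| ≤ √(24 * ε / c) := by
    intro u v hu hv hu2 hv2 h
    refine Real.abs_le_sqrt ?_
    rw [le_div_iff₀ hc]
    have hu3 := Real.sq_sqrt hu
    have hv3 := Real.sq_sqrt hv
    have e1 : (u - v) ^ 2 = (√u - √v) ^ 2 * (√u + √v) ^ 2 := by
      rw [← mul_pow]
      congr 1
      linear_combination -hu3 + hv3
    have e2 : (√u + √v) ^ 2 ≤ 8 := by nlinarith [sq_nonneg (√u - √v)]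
    calc (u - v) ^ 2 * c = (c * (√u - √v) ^ 2) * (√u + √v) ^ 2 := by rw [e1]; ring
      _ ≤ (3 * ε) * 8 := by
        apply mul_le_mul h e2 (by positivity) (by positivity)
      _ = 24 * ε := by ring
  have k1 := b x y hx hy (by linarith) (by linarith) (by nlinarith)
  have k2 := b x' y' hx' hy' (by linarith) (by linarith) (by nlinarith)
  rw [abs_le] at k1 k2
  have l1 : p - ε ≤ x + (1 - θ) * (y - x) := by nlinarith
  have l2 : 1 - p - ε ≤ x' + (1 - θ) * (y' - x') := by nlinarith
  have q1 : (1 - θ) * (y - x) ≤ √(24 * ε / c) := by nlinarith [Real.sqrt_nonneg (24 * ε / c)]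
  have q2 : (1 - θ) * (y' - x') ≤ √(24 * ε / c) := by nlinarith [Real.sqrt_nonneg (24 * ε / c)]
  constructor
  · rw [abs_le]; constructor <;> linarith
  · rw [abs_le]; constructor <;> linarith

lemma tendsto_of_hoelder_near_equality {θ p : ℝ} (h0 : 0 < θ) (h1 : θ < 1) {x x' y y' : ℕ → ℝ}
    (hx : ∀ᶠ n in atTop, 0 ≤ x n) (hx' : ∀ᶠ n in atTop, 0 ≤ x' n) (hy : ∀ᶠ n in atTop, 0 ≤ y n)
    (hy' : ∀ᶠ n in atTop, 0 ≤ y' n)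
    (hxx : ∀ ε > 0, ∀ᶠ n in atTop, x n + x' n ≤ 1 + ε)
    (hyy : ∀ ε > 0, ∀ᶠ n in atTop, y n + y' n ≤ 1 + ε)
    (hp : ∀ ε > 0, ∀ᶠ n in atTop, p - ε ≤ x n ^ θ * y n ^ (1 - θ))
    (hp' : ∀ ε > 0, ∀ᶠ n in atTop, 1 - p - ε ≤ x' n ^ θ * y' n ^ (1 - θ)) :
    Tendsto x atTop (𝓝 p) ∧ Tendsto y atTop (𝓝 p) := by
  set c := min θ (1 - θ)
  have hlim : Tendsto (fun ε => 2 * ε + 2 * √(24 * ε / c)) (𝓝[>] (0 : ℝ)) (𝓝 0) := by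
    have : Continuous (fun ε : ℝ => 2 * ε + 2 * √(24 * ε / c)) := by fun_prop
    have := this.tendsto 0
    simp only [mul_zero, zero_div, Real.sqrt_zero, add_zero] at this
    exact this.mono_left nhdsWithin_le_nhds
  have key : ∀ e > 0, ∀ᶠ n in atTop, |x n - p| < e ∧ |y n - p| < e := by
    intro e he
    obtain ⟨ε, hεe, hε⟩ := ((hlim.eventually (gt_mem_nhds he)).and
      (Ioc_mem_nhdsGT (zero_lt_one (α := ℝ)))).exists
    filter_upwards [hx, hx', hy, hy', hxx ε hε.1, hyy ε hε.1, hp ε hε.1, hp' ε hε.1] with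
      n a1 a2 a3 a4 a5 a6 a7 a8
    obtain ⟨r1, r2⟩ := hoelder_stability h0 h1 hε.1 hε.2 a1 a2 a3 a4 a5 a6 a7 a8
    have := Real.sqrt_nonneg (24 * ε / c)
    exact ⟨by linarith, by linarith⟩
  constructor
  · exact Metric.tendsto_atTop'.2 fun e he => by
      obtain ⟨N, hN⟩ := eventually_atTop.1 (key e he)
      exact ⟨N, fun n hn => (hN n hn.le).1⟩
  · exact Metric.tendsto_atTop'.2 fun e he => by
      obtain ⟨N, hN⟩ := eventually_atTop.1 (key e he)
      exact ⟨N, fun n hn => (hN n hn.le).2⟩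

/-- If the entropy power sums and the distortions of a sequence split into two parts, each part obeys
its asymptotic lower bound, and the whole attains the sum of these bounds, then each part
contributes its proportional share. -/
lemma tendsto_share {t C w₁ w₂ : ℝ} (ht : 0 < t) (hC : 0 < C) (hw₁ : 0 < w₁) (hw₂ : 0 < w₂)
    {s s₁ s₂ d d₁ d₂ : ℕ → ℝ} (hs : Tendsto s atTop atTop)
    (hd : ∀ᶠ n in atTop, 0 < d n)
    (hs₁ : ∀ n, 0 ≤ s₁ n) (hs₂ : ∀ n, 0 ≤ s₂ n) (hd₁ : ∀ n, 0 ≤ d₁ n) (hd₂ : ∀ n, 0 ≤ d₂ n)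
    {K : ℝ} (hss : ∀ᶠ n in atTop, s₁ n + s₂ n ≤ s n + K)
    (hdd : ∀ᶠ n in atTop, d₁ n + d₂ n ≤ d n)
    (hup : ∀ W > w₁ + w₂, ∀ᶠ n in atTop, s n ^ t * d n ≤ C * W ^ (1 + t))
    (hlow₁ : ∀ W, 0 ≤ W → W < w₁ → ∀ᶠ n in atTop, C * W ^ (1 + t) ≤ s₁ n ^ t * d₁ n)
    (hlow₂ : ∀ W, 0 ≤ W → W < w₂ → ∀ᶠ n in atTop, C * W ^ (1 + t) ≤ s₂ n ^ t * d₂ n) :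
    Tendsto (fun n => s₁ n / s n) atTop (𝓝 (w₁ / (w₁ + w₂))) ∧
      Tendsto (fun n => d₁ n / d n) atTop (𝓝 (w₁ / (w₁ + w₂))) := by
  have hspos : ∀ᶠ n in atTop, 0 < s n := hs.eventually_gt_atTop 0
  have hθ : 1 - t / (1 + t) = 1 / (1 + t) := by field_simp; ring
  have hmain : ∀ (v : ℝ) (s' d' : ℕ → ℝ), 0 < v → v ≤ w₁ + w₂ → (∀ n, 0 ≤ s' n) → (∀ n, 0 ≤ d' n) →
      (∀ W, 0 ≤ W → W < v → ∀ᶠ n in atTop, C * W ^ (1 + t) ≤ s' n ^ t * d' n) →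
      ∀ ε > 0, ∀ᶠ n in atTop, v / (w₁ + w₂) - ε ≤
        (s' n / s n) ^ (t / (1 + t)) * (d' n / d n) ^ (1 - t / (1 + t)) := by
    intro v s' d' hv hvw hs' hd' hlow ε hε
    -- Both bounds are relaxed by the relative amount `δ`. Since `(1 - δ) / (1 + δ) ≥ 1 - 2δ` and
    -- the share is at most `1`, the loss is at most `2δ ≤ ε`.
    set δ := min (1 / 2) (ε / 2) with hδ
    have hδ₀ : 0 < δ := by positivity
    have hδ₁ : δ ≤ 1 / 2 := min_le_left _ _
    have hδ₂ : δ ≤ ε / 2 := min_le_right _ _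
    have hw : 0 < w₁ + w₂ := by positivity
    filter_upwards [hspos, hd, hup ((w₁ + w₂) * (1 + δ)) (by nlinarith),
      hlow (v * (1 - δ)) (by apply mul_nonneg <;> linarith) (by nlinarith)] with n a1 a2 a3 a4
    have hW1 : 0 < v * (1 - δ) := mul_pos hv (by linarith)
    have hW : 0 < (w₁ + w₂) * (1 + δ) := by positivity
    have e1 : (s' n / s n) ^ (t / (1 + t)) * (d' n / d n) ^ (1 - t / (1 + t)) =
        ((s' n ^ t * d' n) / (s n ^ t * d n)) ^ (1 / (1 + t)) := by
      have := hs' n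
      have := hd' n
      rw [hθ, mul_div_mul_comm, Real.mul_rpow (by positivity) (by positivity),
        ← Real.div_rpow (hs' n) a1.le, ← Real.rpow_mul (by positivity), mul_one_div]
    have e2 : (v * (1 - δ)) / ((w₁ + w₂) * (1 + δ)) =
        ((C * (v * (1 - δ)) ^ (1 + t)) / (C * ((w₁ + w₂) * (1 + δ)) ^ (1 + t))) ^ (1 / (1 + t)) := by
      rw [mul_div_mul_left _ _ hC.ne', ← Real.div_rpow hW1.le hW.le, ← Real.rpow_mul (by positivity),
        mul_one_div_cancel (by positivity), Real.rpow_one]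
    rw [e1]
    calc v / (w₁ + w₂) - ε ≤ (v * (1 - δ)) / ((w₁ + w₂) * (1 + δ)) := by
          rw [mul_div_mul_comm]
          have h2 : v / (w₁ + w₂) ≤ 1 := (div_le_one hw).2 hvw
          have h3 : 0 < v / (w₁ + w₂) := by positivity
          have h4 : 1 - 2 * δ ≤ (1 - δ) / (1 + δ) := by
            rw [le_div_iff₀ (by linarith)]; nlinarith
          nlinarith
      _ ≤ _ := by
          rw [e2]
          have := mul_pos (Real.rpow_pos_of_pos a1 t) a2
          refine Real.rpow_le_rpow (by positivity) ?_ (by positivity)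
          exact div_le_div₀ (by have := hs' n; have := hd' n; positivity) a4 this a3
  have hp' : 1 - w₁ / (w₁ + w₂) = w₂ / (w₁ + w₂) := by
    rw [eq_div_iff (by positivity), sub_mul, div_mul_cancel₀ _ (by positivity)]; ring
  refine tendsto_of_hoelder_near_equality (θ := t / (1 + t)) (x' := fun n => s₂ n / s n)
    (y' := fun n => d₂ n / d n) (by positivity) ((div_lt_one (by positivity)).2 (by linarith))
    (hspos.mono fun n h => div_nonneg (hs₁ n) h.le) (hspos.mono fun n h => div_nonneg (hs₂ n) h.le)
    (hd.mono fun n h => div_nonneg (hd₁ n) h.le) (hd.mono fun n h => div_nonneg (hd₂ n) h.le)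
    (fun ε hε => ?_) (fun ε hε => ?_) (hmain w₁ s₁ d₁ hw₁ (by linarith) hs₁ hd₁ hlow₁) ?_
  · filter_upwards [hspos, hss, hs.eventually_ge_atTop (K / ε)] with n a1 a2 a3
    rw [div_le_iff₀ hε] at a3
    rw [← add_div, div_le_iff₀ a1]
    linarith
  · filter_upwards [hd, hdd] with n a1 a2
    rw [← add_div, div_le_iff₀ a1]
    nlinarith
  · rw [hp']
    exact hmain w₂ s₂ d₂ hw₂ (by linarith) hs₂ hd₂ hlow₂

/-! ### Scaling, restriction and cutting at two points -/

lemma powerSum_smul {α : ℝ} (hα₀ : 0 < α) (k : ℝ≥0∞) (ν : Measure ℝ) (q : ℝ → ℝ) :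
    powerSum α (k • ν) q = k ^ α * powerSum α ν q := by
  simp only [powerSum, Measure.smul_apply, smul_eq_mul, ENNReal.mul_rpow_of_nonneg _ _ hα₀.le,
    ENNReal.tsum_mul_left]

lemma distortion_smul (r : ℝ) (k : ℝ≥0∞) (ν : Measure ℝ) (q : ℝ → ℝ) :
    distortion r (k • ν) q = k * distortion r ν q := by
  simp only [distortion, lintegral_smul_measure, smul_eq_mul]

lemma distortion_restrict_add_compl (r : ℝ) (ν : Measure ℝ) (q : ℝ → ℝ) {A : Set ℝ}
    (hA : MeasurableSet A) :
    distortion r (ν.restrict A) q + distortion r (ν.restrict Aᶜ) q = distortion r ν q :=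
  lintegral_add_compl _ hA

lemma powerSum_restrict_le {α : ℝ} (hα₀ : 0 < α) (ν : Measure ℝ) (q : ℝ → ℝ) (A : Set ℝ) :
    powerSum α (ν.restrict A) q ≤ powerSum α ν q :=
  ENNReal.tsum_le_tsum fun _ => ENNReal.rpow_le_rpow (Measure.restrict_apply_le _ _) hα₀.le

lemma distortion_restrict_le (r : ℝ) (ν : Measure ℝ) (q : ℝ → ℝ) (A : Set ℝ) :
    distortion r (ν.restrict A) q ≤ distortion r ν q :=
  setLIntegral_le_lintegral _ _

lemma mem_or_mem_of_not_subset {c d : ℝ} {I : Set ℝ} (hI : I.OrdConnected)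
    (h1 : ¬ I ⊆ Set.Ioc c d) (h2 : ¬ I ⊆ (Set.Ioc c d)ᶜ) : c ∈ I ∨ d ∈ I := by
  obtain ⟨x, hx, hxn⟩ := Set.not_subset.1 h1
  obtain ⟨y, hy, hyn⟩ := Set.not_subset.1 h2
  rw [Set.notMem_compl_iff] at hyn
  by_cases hxc : x ≤ c
  · exact Or.inl (hI.out hx hy ⟨hxc, hyn.1.le⟩)
  · have hxd : d < x := by
      by_contra! h
      exact hxn ⟨not_le.1 hxc, h⟩
    exact Or.inr (hI.out hy hx ⟨hyn.2, hxd.le⟩)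

/-- Cutting the cells at the two endpoints of an interval increases the power sum by at most `2`. -/
lemma powerSum_restrict_Ioc_add_compl_le {α : ℝ} (hα₀ : 0 < α) (μ : Measure ℝ)
    [IsProbabilityMeasure μ] {q : ℝ → ℝ} (hq : IsQuantizer q) (c d : ℝ) :
    powerSum α (μ.restrict (Set.Ioc c d)) q + powerSum α (μ.restrict (Set.Ioc c d)ᶜ) q ≤
      powerSum α μ q + 2 := by
  classical
  -- Only the cells of `c` and `d` can meet both parts. For such a cell the second part has mass at
  -- most `1`, which the indicator terms absorb; all other cells lie on one side.
  have key : ∀ a : Set.range q, μ.restrict (Set.Ioc c d) (q ⁻¹' {(a : ℝ)}) ^ α +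
      μ.restrict (Set.Ioc c d)ᶜ (q ⁻¹' {(a : ℝ)}) ^ α ≤ μ (q ⁻¹' {(a : ℝ)}) ^ α +
        ((if a = ⟨q c, c, rfl⟩ then 1 else 0) + (if a = ⟨q d, d, rfl⟩ then 1 else 0)) := by
    intro a
    have hm := hq.measurableSet_cell a
    by_cases h1 : q ⁻¹' {(a : ℝ)} ⊆ Set.Ioc c d
    · rw [Measure.restrict_eq_self _ h1, Measure.restrict_apply hm,
        Set.disjoint_iff_inter_eq_empty.1 (Set.disjoint_compl_right_iff_subset.2 h1),
        measure_empty, ENNReal.zero_rpow_of_pos hα₀, add_zero]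
      exact le_self_add
    by_cases h2 : q ⁻¹' {(a : ℝ)} ⊆ (Set.Ioc c d)ᶜ
    · rw [Measure.restrict_eq_self _ h2, Measure.restrict_apply hm,
        Set.disjoint_iff_inter_eq_empty.1 (Set.subset_compl_iff_disjoint_right.1 h2),
        measure_empty, ENNReal.zero_rpow_of_pos hα₀, zero_add]
      exact le_self_add
    refine add_le_add (ENNReal.rpow_le_rpow (Measure.restrict_apply_le _ _) hα₀.le) ?_
    have h3 : μ.restrict (Set.Ioc c d)ᶜ (q ⁻¹' {(a : ℝ)}) ^ α ≤ 1 :=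
      ENNReal.rpow_le_one ((Measure.restrict_apply_le _ _).trans prob_le_one) hα₀.le
    refine h3.trans ?_
    rcases mem_or_mem_of_not_subset (hq.interval a a.2) h1 h2 with h | h
    · rw [if_pos (c := a = ⟨q c, c, rfl⟩) (Subtype.ext (Eq.symm h))]
      exact le_self_add
    · rw [if_pos (c := a = ⟨q d, d, rfl⟩) (Subtype.ext (Eq.symm h))]
      exact le_add_self
  rw [powerSum, powerSum, ← ENNReal.tsum_add]
  refine (ENNReal.tsum_le_tsum key).trans_eq ?_
  rw [ENNReal.tsum_add, ENNReal.tsum_add, tsum_ite_eq, tsum_ite_eq, powerSum, one_add_one_eq_two]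

/-- Makes the lower bound applicable to restricted (`k = 1`) and conditional (`k = 1 / μ(A)`)
measures, whose densities need not be weakly unimodal. -/
lemma ae_continuousAt_mul_indicator {h : ℝ → ℝ≥0∞} (hc : ∀ᵐ x, ContinuousAt h x) {A : Set ℝ}
    (hA : volume (frontier A) = 0) {k : ℝ≥0∞} (hk : k ≠ ∞) :
    ∀ᵐ x, ContinuousAt (fun x => k * A.indicator h x) x := by
  filter_upwards [hc, compl_mem_ae_iff.2 hA] with x hx hxA
  refine (ENNReal.continuous_const_mul hk).continuousAt.comp ?_
  by_cases hi : x ∈ interior A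
  · refine hx.congr ?_
    filter_upwards [isOpen_interior.mem_nhds hi] with y hy
    rw [Set.indicator_of_mem (interior_subset hy)]
  · have hxc : x ∉ closure A := fun h => hxA ⟨h, hi⟩
    refine (continuousAt_const (y := (0 : ℝ≥0∞))).congr ?_
    filter_upwards [isClosed_closure.isOpen_compl.mem_nhds hxc] with y hy
    rw [Set.indicator_of_notMem fun h => hy (subset_closure h)]

lemma withDensity_mul_indicator {h : ℝ → ℝ≥0∞} (hh : Measurable h) {A : Set ℝ}
    (hA : MeasurableSet A) (k : ℝ≥0∞) :
    volume.withDensity (fun x => k * A.indicator h x) = k • (volume.withDensity h).restrict A := by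
  rw [restrict_withDensity hA, ← withDensity_indicator hA, ← withDensity_smul _ (hh.indicator hA)]
  rfl

lemma lintegral_mul_indicator_rpow {h : ℝ → ℝ≥0∞} (hh : Measurable h) {A : Set ℝ}
    (hA : MeasurableSet A) (k : ℝ≥0∞) {β : ℝ} (hβ : 0 < β) :
    ∫⁻ x, (k * A.indicator h x) ^ β = k ^ β * ∫⁻ x in A, h x ^ β := by
  rw [← lintegral_indicator hA, ← lintegral_const_mul _ ((hh.pow_const β).indicator hA)]
  refine lintegral_congr fun x => ?_
  rw [ENNReal.mul_rpow_of_nonneg _ _ hβ.le]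
  by_cases hx : x ∈ A
  · simp only [Set.indicator_of_mem hx]
  · simp only [Set.indicator_of_notMem hx, ENNReal.zero_rpow_of_pos hβ]

/-! ### Asymptotic optimality and the quantization coefficient -/

lemma exists_lt_rpow_of_one_lt {w b t : ℝ≥0∞} {β : ℝ} (hβ : 0 < β) (hw₀ : w ≠ 0) (hw : w ≠ ∞)
    (hb : 1 < b) (ht : t ≠ 0) (ht' : t ≠ ∞) : ∃ W < w, t * w ^ β < b * (t * W ^ β) := by
  have h0 : t * w ^ β ≠ 0 := mul_ne_zero ht (ENNReal.rpow_pos (pos_iff_ne_zero.2 hw₀) hw).ne'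
  have h1 : t * w ^ β ≠ ∞ := ENNReal.mul_ne_top ht' (ENNReal.rpow_ne_top_of_nonneg hβ.le hw)
  have hlim : Tendsto (fun W => b * (t * W ^ β)) (𝓝[<] w) (𝓝 (b * (t * w ^ β))) := by
    have h2 : Tendsto (fun W : ℝ≥0∞ => W ^ β) (𝓝[<] w) (𝓝 (w ^ β)) :=
      (ENNReal.continuous_rpow_const.tendsto w).mono_left nhdsWithin_le_nhds
    exact ENNReal.Tendsto.const_mul (ENNReal.Tendsto.const_mul h2 (Or.inr ht')) (Or.inl h0)
  have hlt : t * w ^ β < b * (t * w ^ β) := by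
    calc t * w ^ β = 1 * (t * w ^ β) := (one_mul _).symm
      _ < b * (t * w ^ β) := (ENNReal.mul_lt_mul_iff_left h0 h1).2 hb
  have : (𝓝[<] w).NeBot := nhdsLT_neBot_of_exists_lt ⟨0, pos_iff_ne_zero.2 hw₀⟩
  obtain ⟨W, hW1, hW2⟩ := ((hlim.eventually (lt_mem_nhds hlt)).and self_mem_nhdsWithin).exists
  exact ⟨W, hW2, hW1⟩

lemma optimalDistortion_le {r α : ℝ} (ν : Measure ℝ) {q : ℝ → ℝ} (hq : IsQuantizer q) {R : EReal}
    (hR : quantizerEntropy α ν q ≤ R) : optimalDistortion r α ν R ≤ distortion r ν q :=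
  iInf₂_le q ⟨hq, hR⟩

/-- Sequences of quantizers attaining the lower bound are asymptotically optimal. -/
theorem isAsymptoticallyOptimal_of_tendsto {r α : ℝ} (hr : 0 < r) (hα₀ : 0 < α) (hα₁ : α < 1)
    {h : ℝ → ℝ≥0∞} (hh : Measurable h) (hc : ∀ᵐ x, ContinuousAt h x)
    (hw₀ : ∫⁻ x, h x ^ betaOne r α ≠ 0) (hw : ∫⁻ x, h x ^ betaOne r α ≠ ∞) {q : ℕ → ℝ → ℝ}
    (hq : ∀ n, IsQuantizer (q n))
    (hS : Tendsto (fun n => powerSum α (volume.withDensity h) (q n)) atTop (𝓝 ∞))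
    (hSD : Tendsto (fun n => powerSum α (volume.withDensity h) (q n) ^ (r / (1 - α)) *
      distortion r (volume.withDensity h) (q n)) atTop
      (𝓝 (ENNReal.ofReal (ballConst r) * (∫⁻ x, h x ^ betaOne r α) ^ betaTwo r α))) :
    IsAsymptoticallyOptimal r α (volume.withDensity h) q := by
  have h1 : 0 < 1 - α := by linarith
  have ht : 0 < r / (1 - α) := by positivity
  have hβ₂ : 0 < betaTwo r α := by rw [betaTwo_eq hα₁]; positivity
  have hC : ENNReal.ofReal (ballConst r) ≠ 0 := by simpa using ballConst_pos hr
  set ν := volume.withDensity h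
  set w := ∫⁻ x, h x ^ betaOne r α
  have hlim₀ : ENNReal.ofReal (ballConst r) * w ^ betaTwo r α ≠ 0 :=
    mul_ne_zero hC (ENNReal.rpow_pos (pos_iff_ne_zero.2 hw₀) hw).ne'
  have hlim : ENNReal.ofReal (ballConst r) * w ^ betaTwo r α ≠ ∞ :=
    ENNReal.mul_ne_top ENNReal.ofReal_ne_top (ENNReal.rpow_ne_top_of_nonneg hβ₂.le hw)
  refine ⟨hq, (tendsto_quantizerEntropy_top_iff hα₁ ν q).2 hS, ?_⟩
  have hfin : ∀ᶠ n in atTop, powerSum α ν (q n) ^ (r / (1 - α)) ≠ 0 ∧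
      powerSum α ν (q n) ^ (r / (1 - α)) ≠ ∞ ∧ distortion r ν (q n) ≠ 0 := by
    filter_upwards [hSD.eventually (lt_mem_nhds (pos_iff_ne_zero.2 hlim₀)),
      hSD.eventually (gt_mem_nhds (lt_top_iff_ne_top.2 hlim))] with n a1 a2
    have e1 := left_ne_zero_of_mul a1.ne'
    have e2 := right_ne_zero_of_mul a1.ne'
    refine ⟨e1, fun h => ?_, e2⟩
    rw [h, ENNReal.top_mul e2] at a2
    exact lt_irrefl _ a2
  have hle : ∀ n, optimalDistortion r α ν (quantizerEntropy α ν (q n)) ≤ distortion r ν (q n) :=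
    fun n => optimalDistortion_le ν (hq n) le_rfl
  refine tendsto_order.2 ⟨fun a ha => ?_, fun b hb => ?_⟩
  · filter_upwards [hSD.eventually (lt_mem_nhds (pos_iff_ne_zero.2 hlim₀)),
      hSD.eventually (gt_mem_nhds (lt_top_iff_ne_top.2 hlim)), hfin] with n a1 a2 a3
    refine ha.trans_le ?_
    have hDtop : distortion r ν (q n) ≠ ∞ := fun h => by
      rw [h, ENNReal.mul_top a3.1] at a2
      exact lt_irrefl _ a2
    rw [ENNReal.le_div_iff_mul_le (Or.inr a3.2.2) (Or.inr hDtop), one_mul]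
    exact hle n
  · obtain ⟨b', hb1, hb2⟩ := exists_between hb
    obtain ⟨W, hW, hlt⟩ := exists_lt_rpow_of_one_lt hβ₂ hw₀ hw hb1 hC ENNReal.ofReal_ne_top
    obtain ⟨η, hη, hηq⟩ := exists_forall_distortion_lt hr hα₀ hα₁ hh hc hW
    have hK : ENNReal.ofReal (ballConst r) * W ^ betaTwo r α ≠ ∞ :=
      ENNReal.mul_ne_top ENNReal.ofReal_ne_top
        (ENNReal.rpow_ne_top_of_nonneg hβ₂.le (ne_top_of_lt hW))
    have hSt : Tendsto (fun n => powerSum α ν (q n) ^ (r / (1 - α)) * η) atTop (𝓝 ∞) := by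
      have e1 := (ENNReal.continuous_rpow_const (y := r / (1 - α))).tendsto ∞ |>.comp hS
      rw [ENNReal.top_rpow_of_pos ht] at e1
      have e2 := ENNReal.Tendsto.mul_const (b := η) e1 (Or.inl (by simp))
      rwa [ENNReal.top_mul hη.ne'] at e2
    filter_upwards [hfin, hSD.eventually (gt_mem_nhds hlt),
      hSt.eventually (lt_mem_nhds (lt_top_iff_ne_top.2 hK))] with n a1 a2 a3
    -- A competitor with distortion below `η` obeys the lower bound; for any other, `S ^ t * η` is
    -- already larger because `S → ∞`.
    have hopt : ENNReal.ofReal (ballConst r) * W ^ betaTwo r α ≤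
        powerSum α ν (q n) ^ (r / (1 - α)) *
          optimalDistortion r α ν (quantizerEntropy α ν (q n)) := by
      rw [← ENNReal.div_le_iff' a1.1 a1.2.1]
      refine le_iInf₂ fun q' hq' => ENNReal.div_le_of_le_mul' ?_
      have hS' := (quantizerEntropy_le_quantizerEntropy_iff hα₁ ν q' (q n)).1 hq'.2
      by_cases hD : distortion r ν q' < η
      · refine (hηq q' hq'.1 hD).trans ?_
        gcongr
      · refine a3.le.trans ?_
        gcongr
        exact not_lt.1 hD
    refine lt_of_le_of_lt (ENNReal.div_le_of_le_mul ?_) hb2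
    rw [← ENNReal.mul_le_mul_iff_right a1.1 a1.2.1]
    refine a2.le.trans ?_
    calc b' * (ENNReal.ofReal (ballConst r) * W ^ betaTwo r α) ≤ b' *
          (powerSum α ν (q n) ^ (r / (1 - α)) *
          optimalDistortion r α ν (quantizerEntropy α ν (q n))) := by gcongr
      _ = _ := by ring

/-- Asymptotically optimal quantizers asymptotically attain the upper bound. -/
theorem IsAsymptoticallyOptimal.upper {r α p : ℝ} (hr : 0 < r) (hp : r < p) (hα₀ : 0 < α)
    (hα₁ : α < 1) {h : ℝ → ℝ≥0∞} (hh : Measurable h) (hc : ∀ᵐ x, ContinuousAt h x) {B : ℝ≥0∞}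
    (hB : B ≠ ∞) (hhB : ∀ x, h x ≤ B)
    (hmom : ∫⁻ x, ENNReal.ofReal (|x| ^ p) ∂(volume.withDensity h) ≠ ∞)
    {q : ℕ → ℝ → ℝ} (hq : IsAsymptoticallyOptimal r α (volume.withDensity h) q) {W : ℝ≥0∞}
    (hW : ∫⁻ x, h x ^ betaOne r α < W) :
    ∀ᶠ n in atTop, powerSum α (volume.withDensity h) (q n) ≠ ∞ ∧
      distortion r (volume.withDensity h) (q n) ≠ 0 ∧
      powerSum α (volume.withDensity h) (q n) ^ (r / (1 - α)) *
        distortion r (volume.withDensity h) (q n) ≤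
          ENNReal.ofReal (ballConst r) * W ^ betaTwo r α := by
  have h1 : 0 < 1 - α := by linarith
  have ht : 0 < r / (1 - α) := by positivity
  have hβ₂ : 0 < betaTwo r α := by rw [betaTwo_eq hα₁]; positivity
  have hC : ENNReal.ofReal (ballConst r) ≠ 0 := by simpa using ballConst_pos hr
  set ν := volume.withDensity h
  have hS := (tendsto_quantizerEntropy_top_iff hα₁ ν q).1 hq.tendsto_entropy
  obtain ⟨W', hW1, hW2⟩ := exists_between hW
  have hW'₀ : W' ≠ 0 := (bot_lt_of_lt hW1).ne'
  have hW' : W' ≠ ∞ := ne_top_of_lt hW2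
  obtain ⟨s₀, hs₀, hup⟩ := exists_quantizer_distortion_le hr hp hα₀ hα₁ hh hc hB hhB hmom hW' hW1
  set K := ENNReal.ofReal (ballConst r) * W' ^ betaTwo r α
  have hK : K ≠ ∞ := ENNReal.mul_ne_top ENNReal.ofReal_ne_top
    (ENNReal.rpow_ne_top_of_nonneg hβ₂.le hW')
  have hK₀ : K ≠ 0 := mul_ne_zero hC (ENNReal.rpow_pos (pos_iff_ne_zero.2 hW'₀) hW').ne'
  -- The level `s` is kept apart from the power sum of `q n`, which is not yet known to be finite.
  have hopt : ∀ s, s₀ ≤ s → s ≠ ∞ → ∀ n, s ≤ powerSum α ν (q n) →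
      optimalDistortion r α ν (quantizerEntropy α ν (q n)) ≤ K * (s ^ (r / (1 - α)))⁻¹ := by
    intro s hs hs_fin n hsn
    obtain ⟨q', hq', hS', hD'⟩ := hup s hs hs_fin
    exact (optimalDistortion_le ν hq'
      ((quantizerEntropy_le_quantizerEntropy_iff hα₁ ν q' (q n)).2 (hS'.trans hsn))).trans hD'
  have hKb : K < ENNReal.ofReal (ballConst r) * W ^ betaTwo r α :=
    (ENNReal.mul_lt_mul_iff_right hC ENNReal.ofReal_ne_top).2 (ENNReal.rpow_lt_rpow hW2 hβ₂)
  -- The gap between `W'` and `W` leaves room for a ratio that only tends to `1`.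
  have hb : 1 < (ENNReal.ofReal (ballConst r) * W ^ betaTwo r α) / K := by
    rwa [ENNReal.lt_div_iff_mul_lt (Or.inl hK₀) (Or.inl hK), one_mul]
  filter_upwards [hq.tendsto_ratio.eventually (gt_mem_nhds hb),
    hq.tendsto_ratio.eventually (gt_mem_nhds ENNReal.one_lt_top),
    hq.tendsto_ratio.eventually (lt_mem_nhds zero_lt_one),
    hS.eventually (lt_mem_nhds (lt_top_iff_ne_top.2 hs₀))] with n a1 a2 a3 a4
  have hD₀ : distortion r ν (q n) ≠ 0 := (ENNReal.div_pos_iff.1 a3).1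
  have hO₀ : optimalDistortion r α ν (quantizerEntropy α ν (q n)) ≠ 0 := fun h0 => by
    rw [h0, ENNReal.div_zero hD₀] at a2
    exact lt_irrefl _ a2
  have hO : optimalDistortion r α ν (quantizerEntropy α ν (q n)) ≠ ∞ := (ENNReal.div_pos_iff.1 a3).2
  -- With an infinite power sum every finite level would be admissible, making the optimal
  -- distortion `0`; this is excluded by the ratio being finite with nonzero numerator.
  have hSn : powerSum α ν (q n) ≠ ∞ := by
    intro htop
    refine hO₀ (le_antisymm ?_ zero_le)
    have hlim : Tendsto (fun k : ℕ => K * ((k : ℝ≥0∞) ^ (r / (1 - α)))⁻¹) atTop (𝓝 0) := by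
      have e1 := (ENNReal.continuous_rpow_const (y := r / (1 - α))).tendsto ∞ |>.comp
        ENNReal.tendsto_nat_nhds_top
      rw [ENNReal.top_rpow_of_pos ht] at e1
      have e2 := ENNReal.Tendsto.const_mul (a := K) (tendsto_inv_iff.2 e1) (Or.inr hK)
      simpa using e2
    refine ge_of_tendsto hlim ?_
    obtain ⟨k₀, hk₀⟩ := ENNReal.exists_nat_gt hs₀
    filter_upwards [eventually_ge_atTop k₀] with k hk
    exact hopt k (hk₀.le.trans (by exact_mod_cast hk)) (ENNReal.natCast_ne_top k) n (by simp [htop])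
  refine ⟨hSn, hD₀, ?_⟩
  have hSt₀ : powerSum α ν (q n) ^ (r / (1 - α)) ≠ 0 :=
    (ENNReal.rpow_pos (bot_lt_of_lt a4) hSn).ne'
  have hSt : powerSum α ν (q n) ^ (r / (1 - α)) ≠ ∞ := ENNReal.rpow_ne_top_of_nonneg ht.le hSn
  have e1 := (ENNReal.div_lt_iff (Or.inl hO₀) (Or.inl hO)).1 a1
  calc powerSum α ν (q n) ^ (r / (1 - α)) * distortion r ν (q n)
      ≤ powerSum α ν (q n) ^ (r / (1 - α)) * ((ENNReal.ofReal (ballConst r) * W ^ betaTwo r α) / K *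
          (K * (powerSum α ν (q n) ^ (r / (1 - α)))⁻¹)) := by
        gcongr
        refine e1.le.trans ?_
        gcongr
        exact hopt _ a4.le hSn n le_rfl
    _ = (ENNReal.ofReal (ballConst r) * W ^ betaTwo r α) * (K⁻¹ * K) *
          (powerSum α ν (q n) ^ (r / (1 - α)) * (powerSum α ν (q n) ^ (r / (1 - α)))⁻¹) := by
        rw [div_eq_mul_inv _ K]; ring
    _ = _ := by
        rw [ENNReal.inv_mul_cancel hK₀ hK, ENNReal.mul_inv_cancel hSt₀ hSt, mul_one, mul_one]

/-- The lower bound for the density `1_A h`: a restriction inherits small distortion from the whole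
measure. -/
lemma eventually_le_powerSum_restrict_mul_distortion {r α : ℝ} (hr : 0 < r) (hα₀ : 0 < α)
    (hα₁ : α < 1) {h : ℝ → ℝ≥0∞} (hh : Measurable h) (hc : ∀ᵐ x, ContinuousAt h x)
    {q : ℕ → ℝ → ℝ} (hq : ∀ n, IsQuantizer (q n))
    (hD : Tendsto (fun n => distortion r (volume.withDensity h) (q n)) atTop (𝓝 0))
    {A : Set ℝ} (hA : MeasurableSet A) (hfr : volume (frontier A) = 0) {W : ℝ≥0∞}
    (hW : W < ∫⁻ x in A, h x ^ betaOne r α) :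
    ∀ᶠ n in atTop, ENNReal.ofReal (ballConst r) * W ^ betaTwo r α ≤
      powerSum α ((volume.withDensity h).restrict A) (q n) ^ (r / (1 - α)) *
        distortion r ((volume.withDensity h).restrict A) (q n) := by
  have hβ := betaOne_pos hr hα₀ hα₁
  have hW' : W < ∫⁻ x, (1 * A.indicator h x) ^ betaOne r α := by
    rwa [lintegral_mul_indicator_rpow hh hA 1 hβ, ENNReal.one_rpow, one_mul]
  obtain ⟨η, hη, hηq⟩ := exists_forall_distortion_lt hr hα₀ hα₁
    ((hh.indicator hA).const_mul 1) (ae_continuousAt_mul_indicator hc hfr ENNReal.one_ne_top) hW'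
  rw [withDensity_mul_indicator hh hA, one_smul] at hηq
  filter_upwards [hD.eventually (gt_mem_nhds hη)] with n hn
  exact hηq _ (hq n) ((distortion_restrict_le r _ _ A).trans_lt hn)

lemma setLIntegral_rpow_ne_zero {h : ℝ → ℝ≥0∞} (hh : Measurable h) {A : Set ℝ}
    (hA : MeasurableSet A) {β : ℝ} (hβ : 0 < β) (hμA : (volume.withDensity h) A ≠ 0) :
    ∫⁻ x in A, h x ^ β ≠ 0 := by
  intro h0
  refine hμA ?_
  rw [withDensity_apply _ hA, lintegral_eq_zero_iff hh]
  rw [lintegral_eq_zero_iff (hh.pow_const β)] at h0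
  filter_upwards [h0] with x hx
  exact (ENNReal.rpow_eq_zero_iff_of_pos hβ).1 hx

lemma toReal_const_mul_rpow {C W t : ℝ} (hC : 0 ≤ C) (hW : 0 ≤ W) :
    (ENNReal.ofReal C * ENNReal.ofReal W ^ t).toReal = C * W ^ t := by
  rw [ENNReal.toReal_mul, ENNReal.toReal_ofReal hC, ← ENNReal.toReal_rpow, ENNReal.toReal_ofReal hW]

lemma tendsto_of_forall_rpow_bounds {C w e : ℝ} (hw : 0 < w) (he : 0 < e) {f : ℕ → ℝ}
    (hup : ∀ W > w, ∀ᶠ n in atTop, f n ≤ C * W ^ e)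
    (hlow : ∀ W, 0 ≤ W → W < w → ∀ᶠ n in atTop, C * W ^ e ≤ f n) :
    Tendsto f atTop (𝓝 (C * w ^ e)) := by
  have hcont : Tendsto (fun W : ℝ => C * W ^ e) (𝓝 w) (𝓝 (C * w ^ e)) :=
    ((Real.continuous_rpow_const he.le).const_mul C |>.tendsto w)
  refine tendsto_order.2 ⟨fun a ha => ?_, fun b hb => ?_⟩
  · obtain ⟨W, ⟨h1, h2⟩, h3⟩ := (((hcont.mono_left nhdsWithin_le_nhds).eventually
      (lt_mem_nhds ha)).and (nhdsWithin_le_nhds (lt_mem_nhds hw))).and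
      (self_mem_nhdsWithin (s := Set.Iio w)) |>.exists
    filter_upwards [hlow W h2.le h3] with n hn
    exact h1.trans_le hn
  · obtain ⟨W, h1, h3⟩ := ((hcont.mono_left nhdsWithin_le_nhds).eventually
      (gt_mem_nhds hb)).and (self_mem_nhdsWithin (s := Set.Ioi w)) |>.exists
    filter_upwards [hup W h3] with n hn
    exact hn.trans_lt h1

/-! ### Shares of the two parts -/

/-- The restrictions of the power sums and distortions of asymptotically optimal quantizers to a
set `A` that cuts only boundedly many cells. -/
theorem IsAsymptoticallyOptimal.tendsto_restrict {r α p : ℝ} (hr : 0 < r) (hp : r < p) (hα₀ : 0 < α)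
    (hα₁ : α < 1) {h : ℝ → ℝ≥0∞} (hh : Measurable h) (hc : ∀ᵐ x, ContinuousAt h x) {B : ℝ≥0∞}
    (hB : B ≠ ∞) (hhB : ∀ x, h x ≤ B)
    (hmom : ∫⁻ x, ENNReal.ofReal (|x| ^ p) ∂(volume.withDensity h) ≠ ∞)
    (hw : ∫⁻ x, h x ^ betaOne r α ≠ ∞)
    {q : ℕ → ℝ → ℝ} (hq : IsAsymptoticallyOptimal r α (volume.withDensity h) q)
    {A : Set ℝ} (hA : MeasurableSet A) (hfr : volume (frontier A) = 0)
    (hμA : (volume.withDensity h) A ≠ 0) (hμA' : (volume.withDensity h) Aᶜ ≠ 0)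
    (hcut : ∀ n, powerSum α ((volume.withDensity h).restrict A) (q n) +
      powerSum α ((volume.withDensity h).restrict Aᶜ) (q n) ≤
        powerSum α (volume.withDensity h) (q n) + 2) :
    Tendsto (fun n => powerSum α ((volume.withDensity h).restrict A) (q n) /
        powerSum α (volume.withDensity h) (q n)) atTop
        (𝓝 ((∫⁻ x in A, h x ^ betaOne r α) / ∫⁻ x, h x ^ betaOne r α)) ∧
      Tendsto (fun n => powerSum α ((volume.withDensity h).restrict A) (q n)) atTop (𝓝 ∞) ∧
      Tendsto (fun n => powerSum α ((volume.withDensity h).restrict A) (q n) ^ (r / (1 - α)) *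
        distortion r ((volume.withDensity h).restrict A) (q n)) atTop
        (𝓝 (ENNReal.ofReal (ballConst r) * (∫⁻ x in A, h x ^ betaOne r α) ^ betaTwo r α)) := by
  have h1 : 0 < 1 - α := by linarith
  have ht : 0 < r / (1 - α) := by positivity
  have hβ := betaOne_pos hr hα₀ hα₁
  have hβ₂ : betaTwo r α = 1 + r / (1 - α) := betaTwo_eq hα₁
  have hC := ballConst_pos hr
  have hC' : ENNReal.ofReal (ballConst r) ≠ 0 := by simpa using hC
  set ν := volume.withDensity h with hν
  set t := r / (1 - α) with ht_def
  set β := betaOne r α with hβ_def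
  set w₁ := (∫⁻ x in A, h x ^ β).toReal with hw₁_def
  set w₂ := (∫⁻ x in Aᶜ, h x ^ β).toReal with hw₂_def
  have hwA : ∫⁻ x in A, h x ^ β ≠ ∞ := ne_top_of_le_ne_top hw (setLIntegral_le_lintegral _ _)
  have hwA' : ∫⁻ x in Aᶜ, h x ^ β ≠ ∞ := ne_top_of_le_ne_top hw (setLIntegral_le_lintegral _ _)
  have hw₁ : 0 < w₁ := ENNReal.toReal_pos (setLIntegral_rpow_ne_zero hh hA hβ hμA) hwA
  have hw₂ : 0 < w₂ := ENNReal.toReal_pos (setLIntegral_rpow_ne_zero hh hA.compl hβ hμA') hwA'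
  have hwsum : ∫⁻ x, h x ^ β = ENNReal.ofReal (w₁ + w₂) := by
    rw [← lintegral_add_compl _ hA, ENNReal.ofReal_add hw₁.le hw₂.le, ENNReal.ofReal_toReal hwA,
      ENNReal.ofReal_toReal hwA']
  have hS : Tendsto (fun n => powerSum α ν (q n)) atTop (𝓝 ∞) :=
    (tendsto_quantizerEntropy_top_iff hα₁ ν q).1 hq.tendsto_entropy
  have hupper : ∀ W : ℝ, w₁ + w₂ < W → ∀ᶠ n in atTop, powerSum α ν (q n) ≠ ∞ ∧
      distortion r ν (q n) ≠ 0 ∧ powerSum α ν (q n) ^ t * distortion r ν (q n) ≤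
        ENNReal.ofReal (ballConst r) * ENNReal.ofReal W ^ (1 + t) := fun W hW => by
    rw [← hβ₂]
    refine hq.upper hr hp hα₀ hα₁ hh hc hB hhB hmom ?_
    rw [hwsum]
    exact (ENNReal.ofReal_lt_ofReal_iff (by linarith)).2 hW
  have hfin : ∀ᶠ n in atTop, powerSum α ν (q n) ≠ 0 ∧ powerSum α ν (q n) ≠ ∞ ∧
      distortion r ν (q n) ≠ 0 ∧ distortion r ν (q n) ≠ ∞ := by
    filter_upwards [hupper (w₁ + w₂ + 1) (by linarith),
      hS.eventually (lt_mem_nhds ENNReal.zero_lt_top)] with n a1 a2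
    refine ⟨a2.ne', a1.1, a1.2.1, fun hD => ?_⟩
    have := a1.2.2
    rw [hD, ENNReal.mul_top (ENNReal.rpow_pos a2 a1.1).ne', top_le_iff] at this
    exact ENNReal.mul_ne_top ENNReal.ofReal_ne_top
      (ENNReal.rpow_ne_top_of_nonneg (by positivity) ENNReal.ofReal_ne_top) this
  -- `S ^ t * D` stays bounded while `S → ∞`; vanishing distortion is what the lower bounds on the
  -- parts require.
  have hD : Tendsto (fun n => distortion r ν (q n)) atTop (𝓝 0) := by
    set K := ENNReal.ofReal (ballConst r) * ENNReal.ofReal (w₁ + w₂ + 1) ^ (1 + t)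
    have hK : K ≠ ∞ := ENNReal.mul_ne_top ENNReal.ofReal_ne_top
      (ENNReal.rpow_ne_top_of_nonneg (by positivity) ENNReal.ofReal_ne_top)
    have hlim : Tendsto (fun n => K * (powerSum α ν (q n) ^ t)⁻¹) atTop (𝓝 0) := by
      have e1 := (ENNReal.continuous_rpow_const (y := t)).tendsto ∞ |>.comp hS
      rw [ENNReal.top_rpow_of_pos ht] at e1
      have e2 := ENNReal.Tendsto.const_mul (a := K) (tendsto_inv_iff.2 e1) (Or.inr hK)
      simpa using e2
    refine tendsto_of_tendsto_of_tendsto_of_le_of_le' tendsto_const_nhds hlim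
      (Eventually.of_forall fun _ => zero_le) ?_
    filter_upwards [hupper (w₁ + w₂ + 1) (by linarith), hfin] with n a1 a2
    rw [← div_eq_mul_inv, ENNReal.le_div_iff_mul_le
      (Or.inl (ENNReal.rpow_pos (pos_iff_ne_zero.2 a2.1) a2.2.1).ne')
      (Or.inl (ENNReal.rpow_ne_top_of_nonneg ht.le a2.2.1)), mul_comm]
    exact a1.2.2
  have hlower : ∀ E : Set ℝ, MeasurableSet E → volume (frontier E) = 0 →
      ∫⁻ x in E, h x ^ β ≠ ∞ → ∀ W : ℝ, 0 ≤ W → W < (∫⁻ x in E, h x ^ β).toReal →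
      ∀ᶠ n in atTop, ballConst r * W ^ (1 + t) ≤
        (powerSum α (ν.restrict E) (q n)).toReal ^ t * (distortion r (ν.restrict E) (q n)).toReal := by
    intro E hE hEfr hEfin W hW0 hW
    have := eventually_le_powerSum_restrict_mul_distortion hr hα₀ hα₁ hh hc hq.isQuantizer hD hE hEfr
      ((ENNReal.ofReal_lt_iff_lt_toReal hW0 hEfin).2 hW)
    filter_upwards [this, hfin] with n a1 a2
    rw [hβ₂] at a1
    rw [← toReal_const_mul_rpow hC.le hW0, ENNReal.toReal_rpow, ← ENNReal.toReal_mul]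
    refine ENNReal.toReal_mono (ENNReal.mul_ne_top (ENNReal.rpow_ne_top_of_nonneg ht.le ?_) ?_) a1
    · exact ne_top_of_le_ne_top a2.2.1 (powerSum_restrict_le hα₀ ν _ E)
    · exact ne_top_of_le_ne_top a2.2.2.2 (distortion_restrict_le r ν _ E)
  have hupR : ∀ W > w₁ + w₂, ∀ᶠ n in atTop,
      (powerSum α ν (q n)).toReal ^ t * (distortion r ν (q n)).toReal ≤
        ballConst r * W ^ (1 + t) := by
    intro W hW
    filter_upwards [hupper W hW] with n a1
    rw [← toReal_const_mul_rpow hC.le (by linarith), ENNReal.toReal_rpow, ← ENNReal.toReal_mul]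
    exact ENNReal.toReal_mono (ENNReal.mul_ne_top ENNReal.ofReal_ne_top
      (ENNReal.rpow_ne_top_of_nonneg (by positivity) ENNReal.ofReal_ne_top)) a1.2.2
  have hsR : Tendsto (fun n => (powerSum α ν (q n)).toReal) atTop atTop := by
    refine tendsto_atTop.2 fun M => ?_
    filter_upwards [hS.eventually (lt_mem_nhds (ENNReal.ofReal_lt_top (r := M))), hfin] with n a1 a2
    exact (ENNReal.ofReal_le_iff_le_toReal a2.2.1).1 a1.le
  have hspos : ∀ᶠ n in atTop, 0 < (powerSum α ν (q n)).toReal := hsR.eventually_gt_atTop 0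
  have hdpos : ∀ᶠ n in atTop, 0 < (distortion r ν (q n)).toReal :=
    hfin.mono fun n a => ENNReal.toReal_pos a.2.2.1 a.2.2.2
  obtain ⟨hshare, hshareD⟩ := tendsto_share (w₁ := w₁) (w₂ := w₂) (K := 2)
    (s₁ := fun n => (powerSum α (ν.restrict A) (q n)).toReal)
    (s₂ := fun n => (powerSum α (ν.restrict Aᶜ) (q n)).toReal)
    (d₁ := fun n => (distortion r (ν.restrict A) (q n)).toReal)
    (d₂ := fun n => (distortion r (ν.restrict Aᶜ) (q n)).toReal) ht hC hw₁ hw₂ hsR hdpos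
    (fun _ => ENNReal.toReal_nonneg) (fun _ => ENNReal.toReal_nonneg)
    (fun _ => ENNReal.toReal_nonneg) (fun _ => ENNReal.toReal_nonneg)
    (by
      filter_upwards [hfin] with n a
      rw [← ENNReal.toReal_add (ne_top_of_le_ne_top a.2.1 (powerSum_restrict_le hα₀ ν _ A))
        (ne_top_of_le_ne_top a.2.1 (powerSum_restrict_le hα₀ ν _ Aᶜ)),
        ← ENNReal.toReal_ofNat, ← ENNReal.toReal_add a.2.1 (by simp)]
      exact ENNReal.toReal_mono (ENNReal.add_ne_top.2 ⟨a.2.1, by simp⟩) (hcut n))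
    (by
      filter_upwards [hfin] with n a
      rw [← ENNReal.toReal_add (ne_top_of_le_ne_top a.2.2.2 (distortion_restrict_le r ν _ A))
        (ne_top_of_le_ne_top a.2.2.2 (distortion_restrict_le r ν _ Aᶜ)),
        distortion_restrict_add_compl r ν _ hA])
    hupR (hlower A hA hfr hwA) (hlower Aᶜ hA.compl (by rwa [frontier_compl]) hwA')
  have hwhole : Tendsto (fun n => (powerSum α ν (q n)).toReal ^ t * (distortion r ν (q n)).toReal)
      atTop (𝓝 (ballConst r * (w₁ + w₂) ^ (1 + t))) := by
    refine tendsto_of_forall_rpow_bounds (by positivity) (by positivity) hupR fun W hW0 hW => ?_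
    have := hlower Set.univ MeasurableSet.univ (by simp) (by simpa using hw) W hW0
      (by rwa [Measure.restrict_univ, hwsum, ENNReal.toReal_ofReal (by positivity)])
    simpa using this
  have hpos : 0 < w₁ / (w₁ + w₂) := by positivity
  refine ⟨?_, ?_, ?_⟩
  · have e := ENNReal.tendsto_ofReal hshare
    rw [ENNReal.ofReal_div_of_pos (by positivity), ← hwsum, hw₁_def, ENNReal.ofReal_toReal hwA] at e
    refine e.congr' ?_
    filter_upwards [hfin, hspos] with n a a'
    rw [ENNReal.ofReal_div_of_pos a', ENNReal.ofReal_toReal a.2.1, ENNReal.ofReal_toReal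
      (ne_top_of_le_ne_top a.2.1 (powerSum_restrict_le hα₀ ν _ A))]
  · have e := ENNReal.tendsto_ofReal_atTop.comp (hshare.pos_mul_atTop hpos hsR)
    refine e.congr' ?_
    filter_upwards [hfin, hspos] with n a a'
    simp only [Function.comp_apply]
    rw [div_mul_cancel₀ _ a'.ne', ENNReal.ofReal_toReal
      (ne_top_of_le_ne_top a.2.1 (powerSum_restrict_le hα₀ ν _ A))]
  -- `S₁ ^ t * D₁ = (S₁ / S) ^ t * (D₁ / D) * (S ^ t * D)`, with all three limits known.
  · have e := ENNReal.tendsto_ofReal (((hshare.rpow_const (Or.inr ht.le)).mul hshareD).mul hwhole)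
    have hval : (w₁ / (w₁ + w₂)) ^ t * (w₁ / (w₁ + w₂)) * (ballConst r * (w₁ + w₂) ^ (1 + t)) =
        ballConst r * w₁ ^ (1 + t) := by
      have h2 : (w₁ / (w₁ + w₂)) ^ t * (w₁ / (w₁ + w₂)) = (w₁ / (w₁ + w₂)) ^ (1 + t) := by
        rw [Real.rpow_add hpos, Real.rpow_one, mul_comm]
      rw [h2, Real.div_rpow hw₁.le (by positivity)]
      field_simp
    rw [hval, ENNReal.ofReal_mul hC.le, ← ENNReal.ofReal_rpow_of_nonneg hw₁.le (by positivity),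
      hw₁_def, ENNReal.ofReal_toReal hwA, ← hβ₂] at e
    refine e.congr' ?_
    filter_upwards [hfin, hspos, hdpos] with n a a' a''
    have f1 := ne_top_of_le_ne_top a.2.1 (powerSum_restrict_le hα₀ ν (q n) A)
    have f2 := ne_top_of_le_ne_top a.2.2.2 (distortion_restrict_le r ν (q n) A)
    rw [Real.div_rpow ENNReal.toReal_nonneg a'.le, ← mul_div_mul_comm, div_mul_cancel₀ _
      (mul_pos (Real.rpow_pos_of_pos a' t) a'').ne', ENNReal.ofReal_mul
      (Real.rpow_nonneg ENNReal.toReal_nonneg t), ← ENNReal.ofReal_rpow_of_nonneg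
      ENNReal.toReal_nonneg ht.le, ENNReal.ofReal_toReal f1, ENNReal.ofReal_toReal f2]

end RenyiQuantization

/-! ### The theorem: passage to conditional measures -/

open RenyiQuantization in
theorem theorem3p3 (r α : ℝ) (hr : 1 < r) (hα₀ : 0 < α) (hα₁ : α < 1)
    (g : ℝ → ℝ) (hg : RenyiQuantization.IsWeaklyUnimodal g)
    (μ : Measure ℝ) (hμ : μ = RenyiQuantization.densityMeasure g)
    (hmoment : ∃ δ : ℝ, 0 < δ ∧ Integrable (fun x : ℝ => |x| ^ (r + δ)) μ)
    (q : ℕ → ℝ → ℝ) (hq : RenyiQuantization.IsAsymptoticallyOptimal r α μ q)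
    (c d : ℝ) (hcd : c < d) (hpos : 0 < μ (Set.Ioc c d)) (hlt : μ (Set.Ioc c d) < 1) :
    (∫⁻ x, ENNReal.ofReal (g x) ^ RenyiQuantization.betaOne r α) < ∞ ∧
    ∀ A : Set ℝ, A = Set.Ioc c d ∨ A = (Set.Ioc c d)ᶜ →
      Tendsto (fun n =>
          EReal.exp (((1 - α : ℝ) : EReal) * RenyiQuantization.quantizerEntropy α μ[|A] (q n)) /
            EReal.exp (((1 - α : ℝ) : EReal) * RenyiQuantization.quantizerEntropy α μ (q n)))
        atTop
        (𝓝 ((∫⁻ x in A, ENNReal.ofReal (g x) ^ RenyiQuantization.betaOne r α) /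
          (∫⁻ x, ENNReal.ofReal (g x) ^ RenyiQuantization.betaOne r α) * μ A ^ (-α))) ∧
      RenyiQuantization.IsAsymptoticallyOptimal r α μ[|A] q ∧
      RenyiQuantization.quantizationCoeff r α μ[|A] < ∞ ∧
      Tendsto (fun n =>
          EReal.exp ((r : EReal) * RenyiQuantization.quantizerEntropy α μ[|A] (q n)) *
            RenyiQuantization.distortion r μ[|A] (q n))
        atTop (𝓝 (RenyiQuantization.quantizationCoeff r α μ[|A])) := by
  obtain ⟨δ, hδ, hint⟩ := hmoment
  have hr0 : 0 < r := by linarith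
  have hp : r < r + δ := by linarith
  have h1 : 0 < 1 - α := by linarith
  have ht : 0 < r / (1 - α) := by positivity
  have hβ := betaOne_pos hr0 hα₀ hα₁
  have hβ₂ := betaTwo_eq (r := r) hα₁
  set h : ℝ → ℝ≥0∞ := fun x => ENNReal.ofReal (g x) with h_def
  have hh : Measurable h := hg.measurable.ennreal_ofReal
  have hμ' : μ = volume.withDensity h := hμ
  have hc : ∀ᵐ x, ContinuousAt h x := hg.ae_continuousAt.mono fun x hx =>
    ENNReal.continuous_ofReal.continuousAt.comp hx
  obtain ⟨B, hB⟩ := hg.exists_bound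
  have hhB : ∀ x, h x ≤ ENNReal.ofReal B := fun x => ENNReal.ofReal_le_ofReal (hB x)
  have hmom : ∫⁻ x, ENNReal.ofReal (|x| ^ (r + δ)) ∂(volume.withDensity h) ≠ ∞ := by
    rw [← hμ']
    have := hint.lintegral_lt_top
    exact this.ne
  have hone : ∫⁻ x, h x = 1 := hg.lintegral_eq_one
  have hprob : IsProbabilityMeasure μ := ⟨by rw [hμ', withDensity_apply _ .univ]; simpa using hone⟩
  have hw : ∫⁻ x, h x ^ betaOne r α ≠ ∞ :=
    lintegral_rpow_betaOne_ne_top hr0 hp hα₀ hα₁ hh (by simp [hone]) hmom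
  refine ⟨lt_top_iff_ne_top.2 hw, fun A hAcd => ?_⟩
  have hμIoc : μ (Set.Ioc c d)ᶜ ≠ 0 := by
    rw [prob_compl_eq_one_sub measurableSet_Ioc]
    exact (tsub_pos_of_lt hlt).ne'
  have hfrIoc : volume (frontier (Set.Ioc c d)) = 0 := (convex_Ioc c d).addHaar_frontier volume
  have hcutIoc := fun n => powerSum_restrict_Ioc_add_compl_le hα₀ μ (hq.isQuantizer n) c d
  obtain ⟨hA, hfr, hμA, hμA', hcut⟩ : MeasurableSet A ∧ volume (frontier A) = 0 ∧ μ A ≠ 0 ∧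
      μ Aᶜ ≠ 0 ∧ ∀ n, powerSum α (μ.restrict A) (q n) + powerSum α (μ.restrict Aᶜ) (q n) ≤
        powerSum α μ (q n) + 2 := by
    rcases hAcd with rfl | rfl
    · exact ⟨measurableSet_Ioc, hfrIoc, hpos.ne', hμIoc, hcutIoc⟩
    · rw [frontier_compl, compl_compl]
      exact ⟨measurableSet_Ioc.compl, hfrIoc, hμIoc, hpos.ne',
        fun n => by rw [add_comm]; exact hcutIoc n⟩
  obtain ⟨hratio, hS_infty, hSD⟩ : _ ∧ _ ∧ _ := by
    rw [hμ'] at hq hμA hμA' hcut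
    exact hq.tendsto_restrict hr0 hp hα₀ hα₁ hh hc ENNReal.ofReal_ne_top hhB hmom hw hA hfr hμA hμA'
      hcut
  rw [← hμ'] at hratio hS_infty hSD
  set k : ℝ≥0∞ := (μ A)⁻¹ with hk_def
  have hk₀ : k ≠ 0 := ENNReal.inv_ne_zero.2 (measure_ne_top μ A)
  have hk : k ≠ ∞ := ENNReal.inv_ne_top.2 hμA
  have hkα : k ^ α ≠ ∞ := ENNReal.rpow_ne_top_of_nonneg hα₀.le hk
  have hcond : μ[|A] = k • μ.restrict A := rfl
  have hcond' : μ[|A] = volume.withDensity (fun x => k * A.indicator h x) := by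
    rw [withDensity_mul_indicator hh hA, ← hμ', hcond]
  have hS_eq : ∀ n, powerSum α μ[|A] (q n) = k ^ α * powerSum α (μ.restrict A) (q n) := fun n => by
    rw [hcond, powerSum_smul hα₀]
  have hwA₀ : ∫⁻ x in A, h x ^ betaOne r α ≠ 0 :=
    setLIntegral_rpow_ne_zero hh hA hβ (hμ' ▸ hμA)
  have hwA : ∫⁻ x in A, h x ^ betaOne r α ≠ ∞ :=
    ne_top_of_le_ne_top hw (setLIntegral_le_lintegral _ _)
  have hw_cond : ∫⁻ x, (k * A.indicator h x) ^ betaOne r α =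
      k ^ betaOne r α * ∫⁻ x in A, h x ^ betaOne r α := lintegral_mul_indicator_rpow hh hA k hβ
  have hcoeff : quantizationCoeff r α μ[|A] = ENNReal.ofReal (ballConst r) *
      (∫⁻ x, (k * A.indicator h x) ^ betaOne r α) ^ betaTwo r α := by
    rw [quantizationCoeff, hcond', ballConst]
    congr 2
    refine lintegral_congr_ae ?_
    filter_upwards [Measure.rnDeriv_withDensity volume ((hh.indicator hA).const_mul k)] with x hx
    rw [hx]
  have hw_cond₀ : ∫⁻ x, (k * A.indicator h x) ^ betaOne r α ≠ 0 := by
    rw [hw_cond]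
    exact mul_ne_zero (ENNReal.rpow_pos (pos_iff_ne_zero.2 hk₀) hk).ne' hwA₀
  have hw_cond_top : ∫⁻ x, (k * A.indicator h x) ^ betaOne r α ≠ ∞ := by
    rw [hw_cond]
    exact ENNReal.mul_ne_top (ENNReal.rpow_ne_top_of_nonneg hβ.le hk) hwA
  have hS_infty' : Tendsto (fun n => powerSum α μ[|A] (q n)) atTop (𝓝 ∞) := by
    simp only [hS_eq]
    have := ENNReal.Tendsto.const_mul (a := k ^ α) hS_infty (Or.inl (by simp))
    rwa [ENNReal.mul_top (ENNReal.rpow_pos (pos_iff_ne_zero.2 hk₀) hk).ne'] at this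
  have hSD' : Tendsto (fun n => powerSum α μ[|A] (q n) ^ (r / (1 - α)) * distortion r μ[|A] (q n))
      atTop (𝓝 (ENNReal.ofReal (ballConst r) *
        (∫⁻ x, (k * A.indicator h x) ^ betaOne r α) ^ betaTwo r α)) := by
    -- Multiplying the measure by `k` scales `S ^ t * D` by `k ^ (αt + 1)` and the coefficient by `k
    -- ^ (β₁β₂)`; these exponents agree.
    have hexp : betaOne r α * betaTwo r α = α * (r / (1 - α)) + 1 := by
      rw [betaOne, betaTwo]; field_simp; ring
    have e := ENNReal.Tendsto.const_mul (a := k ^ (α * (r / (1 - α)) + 1)) hSD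
      (Or.inr (ENNReal.rpow_ne_top_of_nonneg (by positivity) hk))
    rw [hw_cond, ENNReal.mul_rpow_of_nonneg _ _ (by rw [hβ₂]; positivity), ← ENNReal.rpow_mul, hexp,
      mul_left_comm]
    refine e.congr fun n => ?_
    rw [hS_eq, hcond, distortion_smul, ENNReal.mul_rpow_of_nonneg _ _ ht.le, ← ENNReal.rpow_mul,
      ENNReal.rpow_add_of_nonneg _ _ (by positivity) zero_le_one, ENNReal.rpow_one]
    ring
  refine ⟨?_, ?_, ?_, ?_⟩
  · simp only [exp_one_sub_mul_quantizerEntropy hα₁, hS_eq]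
    have e := ENNReal.Tendsto.mul_const (b := k ^ α) hratio (Or.inr hkα)
    rw [ENNReal.rpow_neg, ← ENNReal.inv_rpow]
    refine e.congr fun n => ?_
    rw [mul_comm, mul_div_assoc]
  · rw [hcond'] at hS_infty' hSD' ⊢
    exact isAsymptoticallyOptimal_of_tendsto hr0 hα₀ hα₁ ((hh.indicator hA).const_mul k)
      (ae_continuousAt_mul_indicator hc hfr hk) hw_cond₀ hw_cond_top hq.isQuantizer hS_infty' hSD'
  · rw [hcoeff]
    exact ENNReal.mul_lt_top ENNReal.ofReal_lt_top (lt_top_iff_ne_top.2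
      (ENNReal.rpow_ne_top_of_nonneg (by rw [hβ₂]; positivity) hw_cond_top))
  · simp only [exp_mul_quantizerEntropy]
    rw [hcoeff]
    exact hSD'
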